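/- Let $\phi(y)=\frac{1}{\sqrt{2\pi}}e^{-y^2/2}$ be the standard normal density, let $h_n(x)=(-1)^n e^{x^2/2}\frac{d^n}{dx^n}e^{-x^2/2}$ be the $n$-th Hermite polynomial and $\widehat h_n=(n!)^{-1/2}h_n$, for $n=0,1,2,\dots$. For $0<q<1$ let $\mathcal H_q$ be the complex Hilbert space of all functions $f\colon\mathbb R\to\mathbb C$ of the form $f(x)=\sum_{n=0}^\infty a_n\widehat h_n(x)$ for all $x \in \mathbb R$, with $a_n\in\mathbb C$ and $\sum_{n=0}^\infty |a_n|^2q^{-n}<\infty$, equipped with the inner product $\langle f,g\rangle_{\mathcal H_q}=\sum_{n=0}^\infty a_n\overline{b_n}\,q^{-n}$ for $f=\sum_n a_n\widehat h_n$, $g=\sum_n b_n\widehat h_n$. Put $r(q)=\sqrt{\frac{1-q}{1+q^{-1}}}$. Fix $0<q<1$. All functions in $\mathcal H_q$ are real-analytic on $\mathbb R$. For every integer $n\ge 0$ the formula $$T^{(n)}f(x)=(-1)^n x^n\frac{1}{n!}\int_0^\infty (f\phi)^{(n)}(y)\,dy$$ has an integrable integrand for every $f\in\mathcal H_q$ and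 defines a bounded linear operator $T^{(n)}\colon\mathcal H_q\to\mathcal H_q$ of rank one. For every real $\rho$ with $|\rho|<r(q)$ the formula $$T_\rho f(x)=\int_{-\rho x}^\infty f(y)\phi(y)\,dy,\qquad x\in\mathbb R,$$ has an integrable integrand for every $f\in\mathcal H_q$ and all $x$, and defines a bounded linear operator $T_\rho\colon\mathcal H_q\to\mathcal H_q$. This operator is compact, and $$T_\rho=\sum_{n=0}^\infty\rho^n T^{(n)},$$ where the series converges in operator norm, with $\sum_{n}\|\rho^nT^{(n)}\|<\infty$. Finally, the radius $r(q)$ is largest for $q^*=\sqrt2-1\in(0,1)$: one has $r(q^*)=\sqrt2-1$, and $r(q)<\sqrt2-1$ for all $q\in(0,1)$ with $q\ne q^*$. -/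

import Mathlib

open MeasureTheory Filter Topology
open scoped ComplexConjugate Nat ENNReal

noncomputable section

namespace HermiteMA

/-- The normalized (probabilists') Hermite polynomial `(n!)^{-1/2} h_n`, as a real function. -/
def hermiteHat (n : ℕ) (x : ℝ) : ℝ :=
  (Polynomial.aeval x (Polynomial.hermite n) : ℝ) / √(n ! : ℝ)

/-! ### Orthogonality of the Hermite polynomials

These facts are needed to see that the coefficients of a function in the space below are unique,
so that its inner product makes sense. -/

lemma integrable_aeval_mul_gauss (p : Polynomial ℤ) :
    Integrable (fun x : ℝ => (Polynomial.aeval x p : ℝ) * Real.exp (-(x ^ 2 / 2))) := by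
  induction p using Polynomial.induction_on' with
  | add p r hp hr =>
    refine (hp.add hr).congr (Eventually.of_forall fun x => ?_)
    simp [add_mul]
  | monomial n c =>
    have h := (integrable_rpow_mul_exp_neg_mul_sq (b := 1 / 2) (by norm_num)
      (s := (n : ℝ)) (by have : (0 : ℝ) ≤ n := n.cast_nonneg
                         linarith)).const_mul (c : ℝ)
    refine h.congr (Eventually.of_forall fun x => ?_)
    have e : -(1 / 2) * x ^ 2 = -(x ^ 2 / 2) := by ring
    simp only [Polynomial.aeval_monomial, Real.rpow_natCast, e]
    simp [mul_assoc]

lemma integral_mul_hermite_succ (p : Polynomial ℤ) (n : ℕ) :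
    ∫ x : ℝ, (Polynomial.aeval x (p * Polynomial.hermite (n + 1)) : ℝ) * Real.exp (-(x ^ 2 / 2)) =
    ∫ x : ℝ, (Polynomial.aeval x (Polynomial.derivative p * Polynomial.hermite n) : ℝ) *
      Real.exp (-(x ^ 2 / 2)) := by
  have h := integral_eq_zero_of_hasDerivAt_of_integrable
    (f := fun x : ℝ => (Polynomial.aeval x (p * Polynomial.hermite n) : ℝ) *
      Real.exp (-(x ^ 2 / 2)))
    (f' := fun x : ℝ =>
      (Polynomial.aeval x (Polynomial.derivative p * Polynomial.hermite n) : ℝ) *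
        Real.exp (-(x ^ 2 / 2)) -
      (Polynomial.aeval x (p * Polynomial.hermite (n + 1)) : ℝ) * Real.exp (-(x ^ 2 / 2)))
    (fun x => by
      have h1 := Polynomial.hasDerivAt_aeval (p * Polynomial.hermite n) x
      have h2 : HasDerivAt (fun x : ℝ => Real.exp (-(x ^ 2 / 2)))
          (Real.exp (-(x ^ 2 / 2)) * (-x)) x := by
        have h3 : HasDerivAt (fun x : ℝ => -(x ^ 2 / 2)) (-x) x := by
          have := ((hasDerivAt_pow 2 x).div_const 2).neg
          refine this.congr_deriv ?_
          norm_num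
        exact h3.exp
      refine (h1.mul h2).congr_deriv ?_
      simp only [Polynomial.hermite_succ, Polynomial.derivative_mul, map_mul, map_add, map_sub,
        Polynomial.aeval_X]
      ring)
    ((integrable_aeval_mul_gauss _).sub (integrable_aeval_mul_gauss _))
    (integrable_aeval_mul_gauss _)
  rw [integral_sub (integrable_aeval_mul_gauss _) (integrable_aeval_mul_gauss _)] at h
  linarith

lemma derivative_hermite_succ (n : ℕ) :
    Polynomial.derivative (Polynomial.hermite (n + 1)) =
      ((n + 1 : ℕ) : Polynomial ℤ) * Polynomial.hermite n := by
  induction n with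
  | zero => simp
  | succ n ih =>
    have h := Polynomial.hermite_succ n
    rw [Polynomial.hermite_succ (n + 1), Polynomial.derivative_sub, Polynomial.derivative_mul, ih,
      Polynomial.derivative_X, Polynomial.derivative_mul, Polynomial.derivative_natCast]
    push_cast
    linear_combination (-((n : Polynomial ℤ) + 1)) * h

lemma integral_hermite_mul_hermite (m n : ℕ) :
    ∫ x : ℝ, (Polynomial.aeval x (Polynomial.hermite m * Polynomial.hermite n) : ℝ) *
      Real.exp (-(x ^ 2 / 2)) = if m = n then (n ! : ℝ) * √(2 * Real.pi) else 0 := by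
  induction n generalizing m with
  | zero =>
    cases m with
    | zero =>
      have h := integral_gaussian (1 / 2)
      have e : ∀ x : ℝ, -(1 / 2) * x ^ 2 = -(x ^ 2 / 2) := fun x => by ring
      simp only [e] at h
      simp [Polynomial.hermite_zero, h]
      ring_nf
    | succ m =>
      rw [mul_comm, integral_mul_hermite_succ]
      simp [Polynomial.hermite_zero]
  | succ n ih =>
    rw [integral_mul_hermite_succ]
    cases m with
    | zero => simp [Polynomial.hermite_zero]
    | succ m =>
      rw [derivative_hermite_succ]
      have e : ∀ x : ℝ, (Polynomial.aeval x (((m + 1 : ℕ) : Polynomial ℤ) *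
          Polynomial.hermite m * Polynomial.hermite n) : ℝ) * Real.exp (-(x ^ 2 / 2)) =
          ((m + 1 : ℕ) : ℝ) * ((Polynomial.aeval x (Polynomial.hermite m * Polynomial.hermite n) : ℝ)
            * Real.exp (-(x ^ 2 / 2))) := fun x => by
        simp only [map_mul, map_natCast]
        ring
      simp only [e]
      rw [integral_const_mul, ih]
      by_cases hmn : m = n
      · subst hmn
        simp [Nat.factorial_succ, mul_assoc]
      · simp [hmn]

lemma hermiteHat_mul_eq (m n : ℕ) (x : ℝ) :
    hermiteHat m x * hermiteHat n x * Real.exp (-(x ^ 2 / 2)) =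
      (√(m ! : ℝ) * √(n ! : ℝ))⁻¹ *
        ((Polynomial.aeval x (Polynomial.hermite m * Polynomial.hermite n) : ℝ) *
          Real.exp (-(x ^ 2 / 2))) := by
  simp only [hermiteHat, map_mul]
  field_simp

lemma integrable_hermiteHat_mul (m n : ℕ) :
    Integrable (fun x => hermiteHat m x * hermiteHat n x * Real.exp (-(x ^ 2 / 2))) := by
  simp only [hermiteHat_mul_eq]
  exact (integrable_aeval_mul_gauss _).const_mul _

lemma integral_hermiteHat_mul (m n : ℕ) :
    ∫ x, hermiteHat m x * hermiteHat n x * Real.exp (-(x ^ 2 / 2)) =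
      if m = n then √(2 * Real.pi) else 0 := by
  simp only [hermiteHat_mul_eq]
  rw [integral_const_mul, integral_hermite_mul_hermite]
  by_cases hmn : m = n
  · subst hmn
    have h : (0 : ℝ) < m ! := by exact_mod_cast m.factorial_pos
    simp only [if_true, Real.mul_self_sqrt h.le]
    field_simp
  · simp [hmn]

lemma integral_abs_hermiteHat_mul_le (m n : ℕ) :
    ∫ x, |hermiteHat m x * hermiteHat n x| * Real.exp (-(x ^ 2 / 2)) ≤ √(2 * Real.pi) * 2 := by
  have h1 := integral_hermiteHat_mul m m
  have h2 := integral_hermiteHat_mul n n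
  simp only [if_true] at h1 h2
  have h3 := integral_add (integrable_hermiteHat_mul m m) (integrable_hermiteHat_mul n n)
  rw [h1, h2] at h3
  have h4 := integral_mono_of_nonneg
    (f := fun x => |hermiteHat m x * hermiteHat n x| * Real.exp (-(x ^ 2 / 2)))
    (Eventually.of_forall fun x => by positivity)
    ((integrable_hermiteHat_mul m m).add (integrable_hermiteHat_mul n n))
    (Eventually.of_forall fun x => by
      have : |hermiteHat m x * hermiteHat n x| ≤
          hermiteHat m x * hermiteHat m x + hermiteHat n x * hermiteHat n x := by
        rw [abs_mul]
        nlinarith [sq_nonneg (|hermiteHat m x| - |hermiteHat n x|), sq_abs (hermiteHat m x),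
          sq_abs (hermiteHat n x), sq_nonneg (hermiteHat m x), sq_nonneg (hermiteHat n x)]
      have := mul_le_mul_of_nonneg_right this (Real.exp_pos (-(x ^ 2 / 2))).le
      simpa [add_mul] using this)
  refine h4.trans (le_of_eq ?_)
  simp only [Pi.add_apply]
  rw [h3]
  ring

/-! ### The space `H_q` -/

/-- `a` is a coefficient sequence of `f`: the sum `∑ |a_n|² q^{-n}` is finite and
`f(x) = ∑ a_n ĥ_n(x)` for every real `x`. -/
def IsHermiteCoeff (q : ℝ) (a : ℕ → ℂ) (f : ℝ → ℂ) : Prop :=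
  Summable (fun n => ‖a n‖ ^ 2 * (q ^ n)⁻¹) ∧
    ∀ x, HasSum (fun n => a n * (hermiteHat n x : ℂ)) (f x)

lemma IsHermiteCoeff.add {q : ℝ} (hq : 0 < q) {a b : ℕ → ℂ} {f g : ℝ → ℂ}
    (hf : IsHermiteCoeff q a f) (hg : IsHermiteCoeff q b g) :
    IsHermiteCoeff q (a + b) (f + g) := by
  refine ⟨Summable.of_nonneg_of_le (fun n => by positivity) (fun n => ?_)
    ((hf.1.add hg.1).mul_left 2), fun x => ?_⟩
  · have h1 : ‖a n + b n‖ ≤ ‖a n‖ + ‖b n‖ := norm_add_le _ _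
    have h2 : ‖a n + b n‖ ^ 2 ≤ 2 * (‖a n‖ ^ 2 + ‖b n‖ ^ 2) := by
      nlinarith [sq_nonneg (‖a n‖ - ‖b n‖), norm_nonneg (a n + b n)]
    have h3 : 0 ≤ (q ^ n)⁻¹ := by positivity
    have := mul_le_mul_of_nonneg_right h2 h3
    simp only [Pi.add_apply]
    linarith
  · simpa [add_mul] using (hf.2 x).add (hg.2 x)

lemma IsHermiteCoeff.smul {q : ℝ} (c : ℂ) {a : ℕ → ℂ} {f : ℝ → ℂ}
    (hf : IsHermiteCoeff q a f) : IsHermiteCoeff q (c • a) (c • f) := by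
  refine ⟨?_, fun x => ?_⟩
  · refine (hf.1.mul_left (‖c‖ ^ 2)).congr fun n => ?_
    simp only [Pi.smul_apply, smul_eq_mul, norm_mul]
    ring
  · simpa [mul_assoc] using (hf.2 x).mul_left c

lemma IsHermiteCoeff.summable_norm {q : ℝ} (hq : 0 < q) (hq1 : q < 1) {a : ℕ → ℂ} {f : ℝ → ℂ}
    (hf : IsHermiteCoeff q a f) : Summable (fun n => ‖a n‖) := by
  refine Summable.of_nonneg_of_le (fun n => norm_nonneg _) (fun n => ?_)
    (hf.1.add (summable_geometric_of_lt_one hq.le hq1))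
  have hp : 0 < q ^ n := by positivity
  rw [← sub_nonneg]
  have : ‖a n‖ ^ 2 * (q ^ n)⁻¹ + q ^ n - ‖a n‖ =
      ((‖a n‖ - q ^ n) ^ 2 + ‖a n‖ * q ^ n) * (q ^ n)⁻¹ := by
    field_simp
    ring
  rw [this]
  positivity

/-- The zero function has only the zero coefficient sequence. -/
lemma IsHermiteCoeff.eq_zero {q : ℝ} (hq : 0 < q) (hq1 : q < 1) {a : ℕ → ℂ}
    (hf : IsHermiteCoeff q a 0) : a = 0 := by
  funext m
  have hint : ∀ n, Integrable (fun x : ℝ => a n *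
      ((hermiteHat n x * hermiteHat m x * Real.exp (-(x ^ 2 / 2)) : ℝ) : ℂ)) := fun n =>
    (integrable_hermiteHat_mul n m).ofReal.const_mul (a n)
  have hs := hasSum_integral_of_summable_integral_norm hint (by
    refine Summable.of_nonneg_of_le (fun n => integral_nonneg fun x => norm_nonneg _) (fun n => ?_)
      ((hf.summable_norm hq hq1).mul_right (√(2 * Real.pi) * 2))
    have e : ∀ x : ℝ, ‖a n * ((hermiteHat n x * hermiteHat m x *
        Real.exp (-(x ^ 2 / 2)) : ℝ) : ℂ)‖ =
        ‖a n‖ * (|hermiteHat n x * hermiteHat m x| * Real.exp (-(x ^ 2 / 2))) := fun x => by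
      rw [norm_mul, Complex.norm_real, Real.norm_eq_abs, abs_mul _ (Real.exp _), Real.abs_exp]
    simp only [e]
    rw [integral_const_mul]
    exact mul_le_mul_of_nonneg_left (integral_abs_hermiteHat_mul_le n m) (norm_nonneg _))
  have h0 : ∀ x : ℝ, ∑' n, a n *
      ((hermiteHat n x * hermiteHat m x * Real.exp (-(x ^ 2 / 2)) : ℝ) : ℂ) = 0 := fun x => by
    have h := (hf.2 x).mul_right ((hermiteHat m x * Real.exp (-(x ^ 2 / 2)) : ℝ) : ℂ)
    simp only [Pi.zero_apply, zero_mul] at h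
    rw [← h.tsum_eq]
    refine tsum_congr fun n => ?_
    push_cast
    ring
  simp only [h0, integral_zero] at hs
  have hv : ∀ n, ∫ x : ℝ, a n *
      ((hermiteHat n x * hermiteHat m x * Real.exp (-(x ^ 2 / 2)) : ℝ) : ℂ) =
      if n = m then a m * (√(2 * Real.pi) : ℂ) else 0 := fun n => by
    rw [integral_const_mul, integral_complex_ofReal, integral_hermiteHat_mul]
    by_cases h : n = m
    · subst h; simp
    · simp [h]
  simp only [hv] at hs
  have h1 := hs.unique (hasSum_ite_eq m _)
  have hpi : (√(2 * Real.pi) : ℂ) ≠ 0 := by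
    exact_mod_cast (Real.sqrt_pos.mpr (by positivity)).ne'
  exact (mul_eq_zero.mp h1.symm).resolve_right hpi

lemma IsHermiteCoeff.unique {q : ℝ} (hq : 0 < q) (hq1 : q < 1) {a b : ℕ → ℂ} {f : ℝ → ℂ}
    (ha : IsHermiteCoeff q a f) (hb : IsHermiteCoeff q b f) : a = b := by
  have h := ha.add hq (hb.smul (-1))
  have e : f + (-1 : ℂ) • f = 0 := by simp
  rw [e] at h
  have := h.eq_zero hq hq1
  funext n
  have hn := congrFun this n
  simp only [Pi.add_apply, Pi.smul_apply, smul_eq_mul, Pi.zero_apply] at hn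
  linear_combination hn

/-- Functions `ℝ → ℂ` with a Hermite expansion in `H_q`, as a vector space of functions. -/
def hermiteSubmodule (q : Set.Ioo (0 : ℝ) 1) : Submodule ℂ (ℝ → ℂ) where
  carrier := {f | ∃ a : ℕ → ℂ, IsHermiteCoeff q a f}
  add_mem' := by
    rintro f g ⟨a, ha⟩ ⟨b, hb⟩
    exact ⟨a + b, ha.add q.2.1 hb⟩
  zero_mem' := ⟨0, by simp [summable_zero], fun x => by simp⟩
  smul_mem' := by
    rintro c f ⟨a, ha⟩
    exact ⟨c • a, ha.smul c⟩

/-- The space `H_q`. It is a separate type so that it carries only the topology of its inner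
product, and not the one of pointwise convergence. -/
def HermiteSpace (q : Set.Ioo (0 : ℝ) 1) : Type := ↥(hermiteSubmodule q)

namespace HermiteSpace

variable {q : Set.Ioo (0 : ℝ) 1}

instance : AddCommGroup (HermiteSpace q) := inferInstanceAs (AddCommGroup ↥(hermiteSubmodule q))

instance : Module ℂ (HermiteSpace q) := inferInstanceAs (Module ℂ ↥(hermiteSubmodule q))

/-- An element of `H_q` is a function `ℝ → ℂ`. -/
instance : FunLike (HermiteSpace q) ℝ ℂ where
  coe f := f.1
  coe_injective := Subtype.val_injective

lemma exists_coeff (f : HermiteSpace q) : ∃ a : ℕ → ℂ, IsHermiteCoeff q a f := f.2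

/-- The sequence of Hermite coefficients of `f`. -/
def coeff (f : HermiteSpace q) : ℕ → ℂ := (exists_coeff f).choose

lemma isHermiteCoeff_coeff (f : HermiteSpace q) : IsHermiteCoeff q f.coeff f :=
  (exists_coeff f).choose_spec

lemma coeff_eq {f : HermiteSpace q} {a : ℕ → ℂ} (h : IsHermiteCoeff q a f) : f.coeff = a :=
  f.isHermiteCoeff_coeff.unique q.2.1 q.2.2 h

lemma coeff_add (f g : HermiteSpace q) : (f + g).coeff = f.coeff + g.coeff :=
  coeff_eq (f.isHermiteCoeff_coeff.add q.2.1 g.isHermiteCoeff_coeff)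

lemma coeff_smul (c : ℂ) (f : HermiteSpace q) : (c • f).coeff = c • f.coeff :=
  coeff_eq (f.isHermiteCoeff_coeff.smul c)

lemma ext_coeff {f g : HermiteSpace q} (h : f.coeff = g.coeff) : f = g := by
  refine DFunLike.ext _ _ fun x => ?_
  have h1 := f.isHermiteCoeff_coeff.2 x
  rw [h] at h1
  exact h1.unique (g.isHermiteCoeff_coeff.2 x)

/-- The inner product `∑ conj(a_n) b_n q^{-n}`; as everywhere in Mathlib it is linear in the
second argument. -/
instance : Inner ℂ (HermiteSpace q) where
  inner f g := ∑' n, conj (f.coeff n) * g.coeff n * (((q : ℝ) ^ n)⁻¹ : ℝ)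

lemma inner_def (f g : HermiteSpace q) :
    inner ℂ f g = ∑' n, conj (f.coeff n) * g.coeff n * (((q : ℝ) ^ n)⁻¹ : ℝ) := rfl

lemma memlp_coeff (f : HermiteSpace q) :
    Memℓp (fun n => f.coeff n * ((√((q : ℝ) ^ n))⁻¹ : ℝ)) 2 := by
  refine memℓp_gen ?_
  refine f.isHermiteCoeff_coeff.1.congr fun n => ?_
  have h : 0 < (q : ℝ) ^ n := pow_pos q.2.1 n
  simp only [ENNReal.toReal_ofNat, Real.rpow_ofNat, norm_mul, Complex.norm_real, mul_pow,
    Real.norm_eq_abs, sq_abs, inv_pow, Real.sq_sqrt h.le]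

/-- The map `f ↦ (q^{-n/2} a_n)` to the sequence space `ℓ²`. -/
def toLp : HermiteSpace q →ₗ[ℂ] lp (fun _ : ℕ => ℂ) 2 where
  toFun f := ⟨fun n => f.coeff n * ((√((q : ℝ) ^ n))⁻¹ : ℝ), f.memlp_coeff⟩
  map_add' f g := by
    ext n
    change (f + g).coeff n * _ = f.coeff n * _ + g.coeff n * _
    rw [coeff_add, Pi.add_apply, add_mul]
  map_smul' c f := by
    ext n
    change (c • f).coeff n * _ = c * (f.coeff n * _)
    rw [coeff_smul, Pi.smul_apply, smul_eq_mul, mul_assoc]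

lemma toLp_apply (f : HermiteSpace q) (n : ℕ) :
    toLp f n = f.coeff n * ((√((q : ℝ) ^ n))⁻¹ : ℝ) := rfl

lemma inner_eq_toLp (f g : HermiteSpace q) : inner ℂ f g = inner ℂ (toLp f) (toLp g) := by
  rw [inner_def, lp.inner_eq_tsum]
  refine tsum_congr fun n => ?_
  have h : 0 < (q : ℝ) ^ n := pow_pos q.2.1 n
  have h2 : (((q : ℝ) ^ n)⁻¹ : ℝ) = (√((q : ℝ) ^ n))⁻¹ * (√((q : ℝ) ^ n))⁻¹ := by
    rw [← mul_inv, Real.mul_self_sqrt h.le]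
  rw [toLp_apply, toLp_apply, h2]
  simp only [RCLike.inner_apply, map_mul, Complex.conj_ofReal]
  push_cast
  ring

lemma toLp_injective : Function.Injective (toLp (q := q)) := by
  intro f g h
  refine ext_coeff (funext fun n => ?_)
  have hn : toLp f n = toLp g n := by rw [h]
  rw [toLp_apply, toLp_apply] at hn
  have h0 : (((√((q : ℝ) ^ n))⁻¹ : ℝ) : ℂ) ≠ 0 := by
    exact_mod_cast (inv_pos.mpr (Real.sqrt_pos.mpr (pow_pos q.2.1 n))).ne'
  exact mul_right_cancel₀ h0 hn

/-- The inner product space axioms. -/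
abbrev core : InnerProductSpace.Core ℂ (HermiteSpace q) where
  conj_inner_symm f g := by rw [inner_eq_toLp, inner_eq_toLp, inner_conj_symm]
  re_inner_nonneg f := by
    rw [inner_eq_toLp]
    exact inner_self_nonneg
  add_left f g h := by simp only [inner_eq_toLp, map_add, inner_add_left]
  smul_left f g c := by simp only [inner_eq_toLp, map_smul, inner_smul_left]
  definite f h := by
    rw [inner_eq_toLp, inner_self_eq_zero] at h
    exact toLp_injective (h.trans (map_zero _).symm)

instance : NormedAddCommGroup (HermiteSpace q) := core.toNormedAddCommGroup

instance : InnerProductSpace ℂ (HermiteSpace q) := InnerProductSpace.ofCore core.toCore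

lemma norm_toLp (f : HermiteSpace q) : ‖toLp f‖ = ‖f‖ := by
  rw [@norm_eq_sqrt_re_inner ℂ, @norm_eq_sqrt_re_inner ℂ _ _ _ _ f, inner_eq_toLp]

end HermiteSpace

/-! ### Completeness of `H_q` -/

lemma aeval_hermite_add_two (n : ℕ) (x : ℝ) :
    (Polynomial.aeval x (Polynomial.hermite (n + 2)) : ℝ) =
      x * Polynomial.aeval x (Polynomial.hermite (n + 1)) -
        (n + 1) * Polynomial.aeval x (Polynomial.hermite n) := by
  rw [Polynomial.hermite_succ (n + 1), derivative_hermite_succ]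
  simp

lemma abs_hermiteHat_add_two_le (n : ℕ) (x : ℝ) :
    |hermiteHat (n + 2) x| ≤
      |x| / √((n : ℝ) + 2) * |hermiteHat (n + 1) x| + |hermiteHat n x| := by
  have hf : (0 : ℝ) < n ! := by exact_mod_cast n.factorial_pos
  have h1 : √(((n + 1)! : ℕ) : ℝ) = √((n : ℝ) + 1) * √(n ! : ℝ) := by
    rw [Nat.factorial_succ, Nat.cast_mul, Real.sqrt_mul (by positivity)]
    push_cast
    rfl
  have h2 : √(((n + 2)! : ℕ) : ℝ) = √((n : ℝ) + 2) * (√((n : ℝ) + 1) * √(n ! : ℝ)) := by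
    rw [Nat.factorial_succ (n + 1), Nat.cast_mul, Real.sqrt_mul (by positivity), h1]
    push_cast
    ring_nf
  have p0 : 0 < √(n ! : ℝ) := Real.sqrt_pos.mpr hf
  have p1 : 0 < √((n : ℝ) + 1) := Real.sqrt_pos.mpr (by positivity)
  have p2 : 0 < √((n : ℝ) + 2) := Real.sqrt_pos.mpr (by positivity)
  have p12 : √((n : ℝ) + 1) ≤ √((n : ℝ) + 2) := Real.sqrt_le_sqrt (by linarith)
  have hs : ((n : ℝ) + 1) = √((n : ℝ) + 1) * √((n : ℝ) + 1) :=
    (Real.mul_self_sqrt (by positivity)).symm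
  have key : hermiteHat (n + 2) x = x / √((n : ℝ) + 2) * hermiteHat (n + 1) x -
      √((n : ℝ) + 1) / √((n : ℝ) + 2) * hermiteHat n x := by
    simp only [hermiteHat, aeval_hermite_add_two, h1, h2]
    rw [div_mul_div_comm, div_mul_div_comm, sub_div]
    congr 1
    rw [div_eq_div_iff (by positivity) (by positivity)]
    nth_rewrite 1 [hs]
    ring
  rw [key]
  refine (abs_sub _ _).trans ?_
  rw [abs_mul, abs_mul, abs_div, abs_div, abs_of_pos p2, abs_of_pos p1]
  have : √((n : ℝ) + 1) / √((n : ℝ) + 2) * |hermiteHat n x| ≤ 1 * |hermiteHat n x| :=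
    mul_le_mul_of_nonneg_right ((div_le_one p2).mpr p12) (abs_nonneg _)
  linarith

lemma summable_hermiteHat_sq {q : ℝ} (hq : 0 < q) (hq1 : q < 1) (x : ℝ) :
    Summable (fun n => hermiteHat n x ^ 2 * q ^ n) := by
  set M : ℕ → ℝ := fun n => max |hermiteHat n x| |hermiteHat (n + 1) x| with hM
  have hM0 : ∀ n, 0 ≤ M n := fun n => (abs_nonneg _).trans (le_max_left _ _)
  have hMs : ∀ n, M (n + 1) ≤ (1 + |x| / √((n : ℝ) + 2)) * M n := fun n => by
    have hx : 0 ≤ |x| / √((n : ℝ) + 2) := by positivity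
    have l1 : |hermiteHat n x| ≤ M n := le_max_left _ _
    have l2 : |hermiteHat (n + 1) x| ≤ M n := le_max_right _ _
    refine max_le ?_ ?_
    · nlinarith [hM0 n, mul_nonneg hx (hM0 n)]
    · have := abs_hermiteHat_add_two_le n x
      nlinarith [mul_le_mul_of_nonneg_left l2 hx]
  have ht : Tendsto (fun n : ℕ => (1 + |x| / √((n : ℝ) + 2)) ^ 2 * q) atTop (𝓝 ((1 + 0) ^ 2 * q)) := by
    refine Tendsto.mul_const _ (Tendsto.pow (tendsto_const_nhds.add ?_) 2)
    refine Tendsto.div_atTop tendsto_const_nhds ?_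
    exact Real.tendsto_sqrt_atTop.comp
      (tendsto_atTop_add_const_right _ _ tendsto_natCast_atTop_atTop)
  obtain ⟨r, hr, hr1⟩ := exists_between hq1
  have hev := ht.eventually_le_const (u := r) (by simpa using hr)
  have hS : Summable (fun n => M n ^ 2 * q ^ n) := by
    refine summable_of_ratio_norm_eventually_le hr1 ?_
    filter_upwards [hev] with n hn
    rw [Real.norm_of_nonneg (by positivity), Real.norm_of_nonneg (by positivity)]
    have h1 : M (n + 1) ^ 2 ≤ ((1 + |x| / √((n : ℝ) + 2)) * M n) ^ 2 :=
      pow_le_pow_left₀ (hM0 _) (hMs n) 2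
    calc M (n + 1) ^ 2 * q ^ (n + 1)
        ≤ ((1 + |x| / √((n : ℝ) + 2)) * M n) ^ 2 * q ^ (n + 1) :=
          mul_le_mul_of_nonneg_right h1 (by positivity)
      _ = ((1 + |x| / √((n : ℝ) + 2)) ^ 2 * q) * (M n ^ 2 * q ^ n) := by ring
      _ ≤ r * (M n ^ 2 * q ^ n) := mul_le_mul_of_nonneg_right hn (by positivity)
  refine Summable.of_nonneg_of_le (fun n => by positivity) (fun n => ?_) hS
  refine mul_le_mul_of_nonneg_right ?_ (by positivity)
  rw [← sq_abs]
  exact pow_le_pow_left₀ (abs_nonneg _) (le_max_left _ _) 2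

/-- Every sequence with `∑ |a_n|² q^{-n} < ∞` is the coefficient sequence of a function. -/
lemma isHermiteCoeff_tsum {q : ℝ} (hq : 0 < q) (hq1 : q < 1) {a : ℕ → ℂ}
    (ha : Summable (fun n => ‖a n‖ ^ 2 * (q ^ n)⁻¹)) :
    IsHermiteCoeff q a (fun x => ∑' n, a n * (hermiteHat n x : ℂ)) := by
  refine ⟨ha, fun x => Summable.hasSum ?_⟩
  refine Summable.of_norm_bounded (ha.add (summable_hermiteHat_sq hq hq1 x)) fun n => ?_
  have hp : 0 < q ^ n := by positivity
  rw [norm_mul, Complex.norm_real, Real.norm_eq_abs, ← sub_nonneg]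
  have : ‖a n‖ ^ 2 * (q ^ n)⁻¹ + hermiteHat n x ^ 2 * q ^ n - ‖a n‖ * |hermiteHat n x| =
      ((‖a n‖ - |hermiteHat n x| * q ^ n) ^ 2 + ‖a n‖ * |hermiteHat n x| * q ^ n) *
        (q ^ n)⁻¹ := by
    rw [← sq_abs (hermiteHat n x)]
    field_simp
    ring
  rw [this]
  positivity

namespace HermiteSpace

variable {q : Set.Ioo (0 : ℝ) 1}

lemma toLp_surjective : Function.Surjective (toLp (q := q)) := by
  intro c
  have hq : ∀ n, 0 < (q : ℝ) ^ n := fun n => pow_pos q.2.1 n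
  have hc : Summable (fun n => ‖c n * (√((q : ℝ) ^ n) : ℂ)‖ ^ 2 * ((q : ℝ) ^ n)⁻¹) := by
    have h := (memℓp_gen_iff (p := 2) (by norm_num)).mp (lp.memℓp c)
    refine h.congr fun n => ?_
    simp only [ENNReal.toReal_ofNat, Real.rpow_ofNat, norm_mul, Complex.norm_real, mul_pow,
      Real.norm_eq_abs, sq_abs, Real.sq_sqrt (hq n).le]
    field_simp [(hq n).ne']
  have hf := isHermiteCoeff_tsum q.2.1 q.2.2 hc
  obtain ⟨F, hF⟩ : ∃ F : HermiteSpace q, IsHermiteCoeff q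
      (fun n => c n * (√((q : ℝ) ^ n) : ℂ)) F := ⟨⟨_, _, hf⟩, hf⟩
  refine ⟨F, ?_⟩
  ext n
  rw [toLp_apply, coeff_eq hF, mul_assoc]
  have h0 : (√((q : ℝ) ^ n) : ℂ) ≠ 0 := by
    exact_mod_cast (Real.sqrt_pos.mpr (hq n)).ne'
  push_cast
  rw [mul_inv_cancel₀ h0, mul_one]

/-- `H_q` is a Hilbert space. -/
instance : CompleteSpace (HermiteSpace q) := by
  have hi : Isometry (toLp (q := q)) := AddMonoidHomClass.isometry_of_norm _ norm_toLp
  rw [completeSpace_iff_isComplete_range hi.isUniformInducing, toLp_surjective.range_eq]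
  exact isComplete_univ

end HermiteSpace

/-! ### The operators -/

/-- The standard normal density `φ`. -/
def stdGaussianPDF (y : ℝ) : ℝ := ProbabilityTheory.gaussianPDFReal 0 1 y

/-- The function `f φ`. -/
def mulGauss (f : ℝ → ℂ) (y : ℝ) : ℂ := f y * (stdGaussianPDF y : ℂ)

/-- The function `x ↦ ∫_{-ρx}^∞ f φ`. -/
def persistenceIntegral (ρ : ℝ) (f : ℝ → ℂ) (x : ℝ) : ℂ :=
  ∫ y in Set.Ioi (-(ρ * x)), mulGauss f y

/-- The function `x ↦ (-1)^n x^n / n! * ∫_0^∞ (f φ)^{(n)}`. -/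
def seriesTerm (n : ℕ) (f : ℝ → ℂ) (x : ℝ) : ℂ :=
  (-1) ^ n * (x : ℂ) ^ n * (1 / (n ! : ℂ)) *
    ∫ y in Set.Ioi (0 : ℝ), iteratedDeriv n (mulGauss f) y

/-- The radius `√((1 - q) / (1 + q⁻¹))`. -/
def radius (q : ℝ) : ℝ := √((1 - q) / (1 + q⁻¹))

end HermiteMA

end

noncomputable section

namespace HermiteMA

/-! ### Functions with a globally bounded sequence of derivatives -/

/-! The operator identity is Taylor's formula for the tail G(y) = ∫_y^∞ fφ, expanded at 0 and
evaluated at y = -ρx. Since G' = -fφ = ∫_y^∞ (fφ)', differentiating G only differentiates the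
integrand, so G^{(n)}(0) = ∫_0^∞ (fφ)^{(n)}, and the n-th Taylor term is ρ^n T^{(n)}f(x).

Two estimates give the radius. First, differentiation raises the index: (ĥ_k φ)' = -√(k+1) ĥ_{k+1}
φ, so (ĥ_k φ)^{(n)} = ±√((k+n)!/k!) ĥ_{k+n} φ, while ∫|ĥ_m φ| ≤ 2 for all m. Cauchy–Schwarz with
weights q^k and ∑ (k+n)!/k! q^k = n!/(1-q)^{n+1} give ∫|(fφ)^{(n)}| ≤ 2‖f‖ √(n!/(1-q)^{n+1})
(`integrable_gaussDeriv`). Second, the Hermite expansion of x^n gives ‖x^n‖² ≤ n!(1+q⁻¹)^n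
(`norm_monomial_le`). After division by n! the factorials cancel and ‖T^{(n)}‖ ≤ 2(1-q)^{-1/2}
r(q)^{-n} (`norm_termCLM_le`), so ∑ρ^n T^{(n)} is dominated by a geometric series.

Point evaluations are bounded, so the norm limit is the pointwise Taylor sum (`tsum_termCLM_apply`);
it is compact as a limit of finite-rank operators. The same derivative bounds give analyticity of
fφ, hence of f. -/

lemma hasDerivAt_taylor_sum {G : ℕ → ℝ → ℂ} (hG : ∀ n y, HasDerivAt (G n) (G (n + 1) y) y)
    (b : ℝ) (N : ℕ) (t : ℝ) :
    HasDerivAt (fun t => ∑ k ∈ Finset.range (N + 1), ((b - t) ^ k / (k ! : ℝ)) • G k t)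
      (((b - t) ^ N / (N ! : ℝ)) • G (N + 1) t) t := by
  induction N with
  | zero => simpa using hG 0 t
  | succ N ih =>
    have h1 : HasDerivAt (fun t : ℝ => (b - t) ^ (N + 1) / ((N + 1)! : ℝ))
        (-((b - t) ^ N / (N ! : ℝ))) t := by
      have h := (((hasDerivAt_id t).const_sub b).pow (N + 1)).div_const ((N + 1)! : ℝ)
      refine h.congr_deriv ?_
      have h0 : (N ! : ℝ) ≠ 0 := by exact_mod_cast N.factorial_ne_zero
      rw [Nat.factorial_succ]
      push_cast
      simp only [id]
      field_simp
    -- Telescoping: differentiating the coefficient of the new term cancels the derivative of the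
    -- previous sum.
    have h2 := ih.add (h1.smul (hG (N + 1) t))
    simp_rw [Finset.sum_range_succ _ (N + 1)]
    refine h2.congr_deriv ?_
    module

/-- Taylor's formula for a function all of whose derivatives have slowly growing global bounds. -/
lemma hasSum_taylor {G : ℕ → ℝ → ℂ} (hG : ∀ n y, HasDerivAt (G n) (G (n + 1) y) y)
    {M : ℕ → ℝ} (hM : ∀ n y, ‖G n y‖ ≤ M n)
    (hs : ∀ R : ℝ, 0 ≤ R → Summable fun n => M n * R ^ n / (n ! : ℝ)) (x z : ℝ) :
    HasSum (fun n => (z ^ n / (n ! : ℝ)) • G n x) (G 0 (x + z)) := by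
  have hsum : Summable (fun n => (z ^ n / (n ! : ℝ)) • G n x) := by
    refine Summable.of_norm_bounded (hs |z| (abs_nonneg z)) fun n => ?_
    rw [norm_smul, norm_div, norm_pow, Real.norm_eq_abs, RCLike.norm_natCast, mul_comm,
      mul_div_assoc]
    exact mul_le_mul_of_nonneg_right (hM n x) (by positivity)
  have hrem : ∀ N : ℕ, ‖G 0 (x + z) -
      ∑ k ∈ Finset.range (N + 1), (z ^ k / (k ! : ℝ)) • G k x‖ ≤
        M (N + 1) * (2 * |z|) ^ (N + 1) / ((N + 1)! : ℝ) := fun N => by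
    have hM0 : 0 ≤ M (N + 1) := (norm_nonneg _).trans (hM (N + 1) x)
    have h0 : (0 : ℝ) < N ! := by exact_mod_cast N.factorial_pos
    -- Mean value inequality in the centre t of the Taylor polynomial, with evaluation point x + z
    -- fixed: t = x gives the polynomial and t = x + z the value `G 0 (x + z)`.
    have h := (convex_segment x (x + z)).norm_image_sub_le_of_norm_hasDerivWithin_le
      (f := fun t => ∑ k ∈ Finset.range (N + 1), ((x + z - t) ^ k / (k ! : ℝ)) • G k t)
      (C := |z| ^ N / (N ! : ℝ) * M (N + 1))
      (fun t _ => (hasDerivAt_taylor_sum hG (x + z) N t).hasDerivWithinAt)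
      (fun t ht => by
        rw [norm_smul, norm_div, norm_pow, Real.norm_eq_abs, RCLike.norm_natCast]
        have ht' : |x + z - t| ≤ |z| := by
          rw [segment_eq_uIcc] at ht
          have := Set.abs_sub_right_of_mem_uIcc ht
          simpa using this
        have := hM (N + 1) t
        gcongr)
      (left_mem_segment ℝ _ _) (right_mem_segment ℝ _ _)
    have e : ∑ k ∈ Finset.range (N + 1), ((x + z - (x + z)) ^ k / (k ! : ℝ)) • G k (x + z) =
        G 0 (x + z) := by
      rw [Finset.sum_range_succ']
      simp
    simp only [e, add_sub_cancel_left, Real.norm_eq_abs] at h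
    refine h.trans ?_
    -- The remainder has N! where (N+1)! is wanted; the missing factor N + 1 is absorbed by
    -- replacing |z| with 2|z|.
    have h2 : ((N + 1 : ℕ) : ℝ) ≤ 2 ^ (N + 1) := by
      exact_mod_cast (Nat.lt_two_pow_self (n := N + 1)).le
    rw [Nat.factorial_succ, mul_pow]
    push_cast at h2 ⊢
    have e2 : |z| ^ N / (N ! : ℝ) * M (N + 1) * |z| =
        M (N + 1) * (((N : ℝ) + 1) * |z| ^ (N + 1)) / (((N : ℝ) + 1) * (N ! : ℝ)) := by
      field_simp
      ring
    rw [e2]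
    gcongr
  have hlim := ((hs (2 * |z|) (by positivity)).tendsto_atTop_zero.comp (tendsto_add_atTop_nat 1))
  have h3 : Tendsto (fun N => ∑ k ∈ Finset.range (N + 1), (z ^ k / (k ! : ℝ)) • G k x) atTop
      (𝓝 (G 0 (x + z))) := by
    rw [tendsto_iff_norm_sub_tendsto_zero]
    refine squeeze_zero (fun _ => norm_nonneg _) (fun N => ?_) hlim
    rw [norm_sub_rev]
    exact hrem N
  have h4 := hsum.hasSum.tendsto_sum_nat.comp (tendsto_add_atTop_nat 1)
  rw [← tendsto_nhds_unique h4 h3]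
  exact hsum.hasSum

lemma analyticAt_of_hasDerivAt_bound {G : ℕ → ℝ → ℂ}
    (hG : ∀ n y, HasDerivAt (G n) (G (n + 1) y) y)
    {M : ℕ → ℝ} (hM : ∀ n y, ‖G n y‖ ≤ M n)
    (hs : ∀ R : ℝ, 0 ≤ R → Summable fun n => M n * R ^ n / (n ! : ℝ)) (x : ℝ) :
    AnalyticAt ℝ (G 0) x := by
  let p : FormalMultilinearSeries ℝ ℝ ℂ := fun n =>
    ContinuousMultilinearMap.mkPiRing ℝ (Fin n) ((n ! : ℝ)⁻¹ • G n x)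
  refine HasFPowerSeriesAt.analyticAt (p := p)
    (hasFPowerSeriesAt_iff.mpr (Eventually.of_forall fun z => ?_))
  have e : ∀ n, z ^ n • p.coeff n = (z ^ n / (n ! : ℝ)) • G n x := fun n => by
    rw [div_eq_mul_inv, mul_smul]
    congr 1
    simp [p, FormalMultilinearSeries.coeff]
  simpa only [e] using hasSum_taylor hG hM hs x z

lemma iteratedDeriv_eq_of_hasDerivAt {G : ℕ → ℝ → ℂ}
    (hG : ∀ n y, HasDerivAt (G n) (G (n + 1) y) y) (n : ℕ) : iteratedDeriv n (G 0) = G n := by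
  induction n with
  | zero => exact iteratedDeriv_zero
  | succ n ih =>
    rw [iteratedDeriv_succ, ih]
    exact funext fun y => (hG n y).deriv

/-! ### Series of integrable functions and square summable sequences -/

/-- Tonelli for the norms. Continuity of the sum serves only to make it measurable. -/
lemma integrable_tsum {F : ℕ → ℝ → ℂ} (hF : ∀ k, Integrable (F k))
    (hs : Summable fun k => ∫ y, ‖F k y‖) (hc : Continuous fun y => ∑' k, F k y) :
    Integrable (fun y => ∑' k, F k y) ∧ ∫ y, ‖∑' k, F k y‖ ≤ ∑' k, ∫ y, ‖F k y‖ := by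
  have h : ∫⁻ y, ‖∑' k, F k y‖ₑ ≤ ENNReal.ofReal (∑' k, ∫ y, ‖F k y‖) := by
    calc ∫⁻ y, ‖∑' k, F k y‖ₑ ≤ ∫⁻ y, ∑' k, ‖F k y‖ₑ :=
          lintegral_mono fun y => enorm_tsum_le_tsum_enorm
      _ = ∑' k, ∫⁻ y, ‖F k y‖ₑ := lintegral_tsum fun k => (hF k).1.enorm
      _ = ∑' k, ENNReal.ofReal (∫ y, ‖F k y‖) :=
          tsum_congr fun k => (ofReal_integral_norm_eq_lintegral_enorm (hF k)).symm
      _ = ENNReal.ofReal (∑' k, ∫ y, ‖F k y‖) :=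
          (ENNReal.ofReal_tsum_of_nonneg (fun k => integral_nonneg fun y => norm_nonneg _) hs).symm
  refine ⟨⟨hc.aestronglyMeasurable, h.trans_lt ENNReal.ofReal_lt_top⟩, ?_⟩
  rw [integral_norm_eq_lintegral_enorm hc.aestronglyMeasurable]
  exact ENNReal.toReal_le_of_le_ofReal
    (tsum_nonneg fun k => integral_nonneg fun y => norm_nonneg _) h

/-- The weighted Cauchy–Schwarz inequality. -/
lemma summable_and_tsum_mul_le {a b w : ℕ → ℝ} (ha : ∀ k, 0 ≤ a k) (hb : ∀ k, 0 ≤ b k)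
    (hw : ∀ k, 0 < w k) (has : Summable fun k => a k ^ 2 * (w k)⁻¹)
    (hbs : Summable fun k => b k ^ 2 * w k) :
    Summable (fun k => a k * b k) ∧
      ∑' k, a k * b k ≤ √(∑' k, a k ^ 2 * (w k)⁻¹) * √(∑' k, b k ^ 2 * w k) := by
  have e1 : ∀ k, (a k * (√(w k))⁻¹) ^ (2 : ℝ) = a k ^ 2 * (w k)⁻¹ := fun k => by
    rw [Real.rpow_two, mul_pow, inv_pow, Real.sq_sqrt (hw k).le]
  have e2 : ∀ k, (b k * √(w k)) ^ (2 : ℝ) = b k ^ 2 * w k := fun k => by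
    rw [Real.rpow_two, mul_pow, Real.sq_sqrt (hw k).le]
  have e3 : ∀ k, (a k * (√(w k))⁻¹) * (b k * √(w k)) = a k * b k := fun k => by
    have := (Real.sqrt_pos.mpr (hw k)).ne'
    field_simp
  have h := Real.summable_and_inner_le_Lp_mul_Lq_tsum_of_nonneg (p := 2) (q := 2)
    (f := fun k => a k * (√(w k))⁻¹) (g := fun k => b k * √(w k))
    Real.HolderConjugate.two_two
    (fun k => mul_nonneg (ha k) (by positivity)) (fun k => mul_nonneg (hb k) (by positivity))
    (by simpa only [e1] using has) (by simpa only [e2] using hbs)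
  simp only [e1, e2, e3, ← Real.sqrt_eq_rpow] at h
  exact h

/-! ### Hermite functions -/

lemma stdGaussianPDF_eq (y : ℝ) :
    stdGaussianPDF y = (√(2 * Real.pi))⁻¹ * Real.exp (-(y ^ 2 / 2)) := by
  simp [stdGaussianPDF, ProbabilityTheory.gaussianPDFReal, neg_div]

lemma stdGaussianPDF_pos (y : ℝ) : 0 < stdGaussianPDF y := by
  rw [stdGaussianPDF_eq]
  positivity

/-- The function `ĥ_m φ`. -/
def hermiteFun (m : ℕ) (y : ℝ) : ℝ := hermiteHat m y * stdGaussianPDF y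

lemma hermiteHat_zero (y : ℝ) : hermiteHat 0 y = 1 := by
  simp [hermiteHat, Polynomial.hermite_zero]

lemma sqrt_factorial_succ (m : ℕ) :
    √((m + 1)! : ℝ) = √((m : ℝ) + 1) * √(m ! : ℝ) := by
  rw [Nat.factorial_succ, Nat.cast_mul, Real.sqrt_mul (by positivity)]
  push_cast
  rfl

/-- The recursion h_{m+1} = x h_m - h_m' says that d/dx acts on h_m φ as minus the raising operator;
the normalization contributes √(m+1). -/
lemma hasDerivAt_hermiteFun (m : ℕ) (y : ℝ) :
    HasDerivAt (hermiteFun m) (-√((m : ℝ) + 1) * hermiteFun (m + 1) y) y := by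
  have h1 := Polynomial.hasDerivAt_aeval (Polynomial.hermite m) y
  have h2 : HasDerivAt (fun x : ℝ => Real.exp (-(x ^ 2 / 2)))
      (Real.exp (-(y ^ 2 / 2)) * (-y)) y := by
    have h3 : HasDerivAt (fun x : ℝ => -(x ^ 2 / 2)) (-y) y := by
      refine ((hasDerivAt_pow 2 y).div_const 2).neg.congr_deriv ?_
      norm_num
    exact h3.exp
  have h := ((h1.mul h2).const_mul ((√(2 * Real.pi))⁻¹ * (√(m ! : ℝ))⁻¹))
  have e : hermiteFun m = fun x => (√(2 * Real.pi))⁻¹ * (√(m ! : ℝ))⁻¹ *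
      (Polynomial.aeval x (Polynomial.hermite m) * Real.exp (-(x ^ 2 / 2))) := by
    funext x
    rw [hermiteFun, stdGaussianPDF_eq, hermiteHat]
    ring
  rw [e]
  refine h.congr_deriv ?_
  have p0 : √(m ! : ℝ) ≠ 0 := by positivity
  have p1 : √((m : ℝ) + 1) ≠ 0 := by positivity
  rw [hermiteFun, stdGaussianPDF_eq, hermiteHat, sqrt_factorial_succ, Polynomial.hermite_succ]
  simp only [map_sub, map_mul, Polynomial.aeval_X]
  field_simp
  ring

lemma hermiteFun_eq (m : ℕ) (y : ℝ) : hermiteFun m y = (√(2 * Real.pi))⁻¹ *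
    (hermiteHat m y * hermiteHat 0 y * Real.exp (-(y ^ 2 / 2))) := by
  rw [hermiteFun, stdGaussianPDF_eq, hermiteHat_zero]
  ring

lemma integrable_hermiteFun (m : ℕ) : Integrable (hermiteFun m) := by
  rw [funext (hermiteFun_eq m)]
  exact (integrable_hermiteHat_mul m 0).const_mul _

/-- Comes from |ĥ_m · 1| ≤ ĥ_m² + 1, whose Gaussian mean is 2. Uniformity in m is what matters. -/
lemma integral_abs_hermiteFun_le (m : ℕ) : ∫ y, |hermiteFun m y| ≤ 2 := by
  have h := integral_abs_hermiteHat_mul_le m 0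
  have hp : 0 < √(2 * Real.pi) := by positivity
  simp_rw [hermiteFun_eq, abs_mul _ (_ * Real.exp _), abs_mul _ (Real.exp _), Real.abs_exp,
    abs_of_pos (inv_pos.mpr hp)]
  rw [integral_const_mul, inv_mul_le_iff₀ hp]
  exact h

lemma integral_Ioi_hermiteFun_succ (m : ℕ) (y : ℝ) :
    √((m : ℝ) + 1) * ∫ t in Set.Ioi y, hermiteFun (m + 1) t = hermiteFun m y := by
  have hi : IntegrableOn (fun t => -√((m : ℝ) + 1) * hermiteFun (m + 1) t) (Set.Ioi y) :=
    ((integrable_hermiteFun (m + 1)).const_mul _).integrableOn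
  have h := integral_Ioi_of_hasDerivAt_of_tendsto' (fun t _ => hasDerivAt_hermiteFun m t) hi
    (tendsto_zero_of_hasDerivAt_of_integrableOn_Ioi (fun t _ => hasDerivAt_hermiteFun m t) hi
      (integrable_hermiteFun m).integrableOn)
  rw [integral_const_mul] at h
  linarith

/-- A sup bound from the L¹ bound on the derivative; the loss √(m+1) is harmless. -/
lemma abs_hermiteFun_le (m : ℕ) (y : ℝ) : |hermiteFun m y| ≤ 2 * √((m : ℝ) + 1) := by
  rw [← integral_Ioi_hermiteFun_succ, abs_mul, abs_of_nonneg (Real.sqrt_nonneg _), mul_comm]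
  refine mul_le_mul_of_nonneg_right ?_ (Real.sqrt_nonneg _)
  refine (abs_integral_le_integral_abs).trans ?_
  exact (setIntegral_le_integral (integrable_hermiteFun _).abs
    (Eventually.of_forall fun t => abs_nonneg _)).trans (integral_abs_hermiteFun_le _)

/-! ### Derivatives of `f φ` -/

/-- The factor in `(ĥ_k φ)^{(n)} = derivFactor n k * ĥ_{k+n} φ`. -/
def derivFactor (n k : ℕ) : ℝ := (-1) ^ n * √(((k + n)! : ℝ) / (k ! : ℝ))

lemma abs_derivFactor (n k : ℕ) : |derivFactor n k| = √(((k + n)! : ℝ) / (k ! : ℝ)) := by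
  rw [derivFactor, abs_mul, abs_pow, abs_neg, abs_one, one_pow, one_mul,
    abs_of_nonneg (Real.sqrt_nonneg _)]

lemma derivFactor_zero (k : ℕ) : derivFactor 0 k = 1 := by
  have : (k ! : ℝ) ≠ 0 := by positivity
  simp [derivFactor, this]

lemma derivFactor_succ (n k : ℕ) :
    derivFactor (n + 1) k = derivFactor n k * -√(((k + n : ℕ) : ℝ) + 1) := by
  rw [derivFactor, derivFactor, ← add_assoc, Nat.factorial_succ (k + n), Nat.cast_mul,
    mul_div_assoc, Real.sqrt_mul (by positivity)]
  push_cast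
  ring

/-- The loss √(k+n+1) in the sup bound is exactly the ratio of consecutive factors, so sup bounds at
order n reduce to sums at order n + 1. -/
lemma abs_derivFactor_mul_hermiteFun_le (n k : ℕ) (y : ℝ) :
    |derivFactor n k * hermiteFun (k + n) y| ≤ 2 * |derivFactor (n + 1) k| := by
  rw [derivFactor_succ, abs_mul, abs_mul, abs_neg, abs_of_nonneg (Real.sqrt_nonneg _)]
  have := mul_le_mul_of_nonneg_left (abs_hermiteFun_le (k + n) y) (abs_nonneg (derivFactor n k))
  linarith

/-- The norm of the sequence `derivFactor n` with respect to the weights `q^k`. -/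
def derivBound (q : ℝ) (n : ℕ) : ℝ := √((n ! : ℝ) / (1 - q) ^ (n + 1))

/-- This is n! times the negative binomial series ∑ C(k+n, n) q^k. -/
lemma hasSum_derivFactor_sq {q : ℝ} (hq : 0 < q) (hq1 : q < 1) (n : ℕ) :
    HasSum (fun k => |derivFactor n k| ^ 2 * q ^ k) ((n ! : ℝ) / (1 - q) ^ (n + 1)) := by
  have h := (hasSum_choose_mul_geometric_of_norm_lt_one n (r := q)
    (by rwa [Real.norm_of_nonneg hq.le])).mul_left (n ! : ℝ)
  rw [mul_one_div] at h
  refine (funext fun k => ?_ : (fun k => |derivFactor n k| ^ 2 * q ^ k) = _) ▸ h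
  rw [abs_derivFactor, Real.sq_sqrt (by positivity), ← mul_assoc, Nat.add_choose,
    Nat.cast_div (Nat.factorial_mul_factorial_dvd_factorial_add k n) (by positivity)]
  have : (n ! : ℝ) ≠ 0 := by positivity
  push_cast
  field_simp

/-- The norm of a sequence with respect to the weights `q^{-k}`. -/
def weightedNorm (q : ℝ) (a : ℕ → ℂ) : ℝ := √(∑' k, ‖a k‖ ^ 2 * (q ^ k)⁻¹)

/-! ### Derivatives and tail integrals of Hermite series times φ -/

section Series

variable {q : ℝ} {a : ℕ → ℂ}

lemma summable_norm_mul_derivFactor (hq : 0 < q) (hq1 : q < 1)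
    (ha : Summable fun k => ‖a k‖ ^ 2 * (q ^ k)⁻¹) (n : ℕ) :
    Summable (fun k => ‖a k‖ * |derivFactor n k|) ∧
      ∑' k, ‖a k‖ * |derivFactor n k| ≤ weightedNorm q a * derivBound q n := by
  have h := hasSum_derivFactor_sq hq hq1 n
  have h2 := summable_and_tsum_mul_le (fun k => norm_nonneg (a k))
    (fun k => abs_nonneg (derivFactor n k)) (fun k => pow_pos hq k) ha h.summable
  rwa [h.tsum_eq] at h2

/-- The `n`-th derivative of `∑ a_k ĥ_k φ`. -/
def gaussDeriv (a : ℕ → ℂ) (n : ℕ) (y : ℝ) : ℂ :=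
  ∑' k, a k * ((derivFactor n k * hermiteFun (k + n) y : ℝ) : ℂ)

lemma norm_gaussDeriv_term_le (a : ℕ → ℂ) (n k : ℕ) (y : ℝ) :
    ‖a k * ((derivFactor n k * hermiteFun (k + n) y : ℝ) : ℂ)‖ ≤
      2 * (‖a k‖ * |derivFactor (n + 1) k|) := by
  rw [norm_mul, Complex.norm_real, Real.norm_eq_abs]
  have := mul_le_mul_of_nonneg_left (abs_derivFactor_mul_hermiteFun_le n k y) (norm_nonneg (a k))
  linarith

lemma hasDerivAt_gaussDeriv (hq : 0 < q) (hq1 : q < 1)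
    (ha : Summable fun k => ‖a k‖ ^ 2 * (q ^ k)⁻¹) (n : ℕ) (y : ℝ) :
    HasDerivAt (gaussDeriv a n) (gaussDeriv a (n + 1) y) y := by
  -- The differentiated series is dominated uniformly by the factors of order n + 2; the original
  -- series need only converge at one point, here 0.
  refine hasDerivAt_tsum (y₀ := 0)
    ((summable_norm_mul_derivFactor hq hq1 ha (n + 2)).1.mul_left 2) (fun k t => ?_)
    (fun k t => norm_gaussDeriv_term_le a (n + 1) k t)
    (Summable.of_norm_bounded
      ((summable_norm_mul_derivFactor hq hq1 ha (n + 1)).1.mul_left 2)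
      fun k => norm_gaussDeriv_term_le a n k 0) y
  have h := ((hasDerivAt_hermiteFun (k + n) t).const_mul (derivFactor n k)).ofReal_comp.const_mul
    (a k)
  refine h.congr_deriv ?_
  rw [derivFactor_succ, mul_assoc, ← add_assoc]

lemma integrable_gaussDeriv (hq : 0 < q) (hq1 : q < 1)
    (ha : Summable fun k => ‖a k‖ ^ 2 * (q ^ k)⁻¹) (n : ℕ) :
    Integrable (gaussDeriv a n) ∧
      ∫ y, ‖gaussDeriv a n y‖ ≤ 2 * (weightedNorm q a * derivBound q n) := by
  obtain ⟨hs, hle⟩ := summable_norm_mul_derivFactor hq hq1 ha n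
  have hb : ∀ k, ∫ y, ‖a k * ((derivFactor n k * hermiteFun (k + n) y : ℝ) : ℂ)‖ ≤
      2 * (‖a k‖ * |derivFactor n k|) := fun k => by
    simp_rw [norm_mul, Complex.norm_real, Real.norm_eq_abs, abs_mul]
    rw [integral_const_mul, integral_const_mul, ← mul_assoc, mul_comm]
    exact mul_le_mul_of_nonneg_right (integral_abs_hermiteFun_le _) (by positivity)
  have hsi := Summable.of_nonneg_of_le (fun k => integral_nonneg fun y => norm_nonneg _) hb
    (hs.mul_left 2)
  obtain ⟨h1, h2⟩ := integrable_tsum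
    (fun k => ((integrable_hermiteFun (k + n)).const_mul (derivFactor n k)).ofReal.const_mul (a k))
    hsi (continuous_iff_continuousAt.mpr fun y =>
      (hasDerivAt_gaussDeriv hq hq1 ha n y).continuousAt)
  refine ⟨h1, h2.trans ?_⟩
  refine (hsi.tsum_le_tsum hb (hs.mul_left 2)).trans ?_
  rw [tsum_mul_left]
  linarith

/-- The integral of `gaussDeriv a n` over a half-line. -/
def gaussTail (a : ℕ → ℂ) (n : ℕ) (y : ℝ) : ℂ := ∫ t in Set.Ioi y, gaussDeriv a n t

lemma gaussTail_succ (hq : 0 < q) (hq1 : q < 1)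
    (ha : Summable fun k => ‖a k‖ ^ 2 * (q ^ k)⁻¹) (n : ℕ) (y : ℝ) :
    gaussTail a (n + 1) y = -gaussDeriv a n y := by
  have hi := (integrable_gaussDeriv hq hq1 ha (n + 1)).1.integrableOn (s := Set.Ioi y)
  have hd := hasDerivAt_gaussDeriv hq hq1 ha n
  rw [gaussTail, integral_Ioi_of_hasDerivAt_of_tendsto' (fun t _ => hd t) hi
    (tendsto_zero_of_hasDerivAt_of_integrableOn_Ioi (fun t _ => hd t) hi
      (integrable_gaussDeriv hq hq1 ha n).1.integrableOn), zero_sub]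

/-- The tails form a tower of derivatives in their own right, so Taylor's formula applies to them,
with Taylor coefficients at 0 given by the integrals of (fφ)^{(n)} over the positive half-line. -/
lemma hasDerivAt_gaussTail (hq : 0 < q) (hq1 : q < 1)
    (ha : Summable fun k => ‖a k‖ ^ 2 * (q ^ k)⁻¹) (n : ℕ) (y : ℝ) :
    HasDerivAt (gaussTail a n) (gaussTail a (n + 1) y) y := by
  cases n with
  | zero =>
    have hi := (integrable_gaussDeriv hq hq1 ha 0).1
    have hc : Continuous (gaussDeriv a 0) := continuous_iff_continuousAt.mpr fun y =>
      (hasDerivAt_gaussDeriv hq hq1 ha 0 y).continuousAt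
    have e : gaussTail a 0 = fun y => gaussTail a 0 0 - ∫ t in (0 : ℝ)..y, gaussDeriv a 0 t := by
      funext y
      rw [gaussTail, gaussTail, ← intervalIntegral.integral_interval_add_Ioi
        (a := 0) (b := y) hi.integrableOn hi.integrableOn]
      ring
    rw [gaussTail_succ hq hq1 ha, e]
    exact (hc.integral_hasStrictDerivAt 0 y).hasDerivAt.const_sub _
  | succ n =>
    rw [gaussTail_succ hq hq1 ha (n + 1), funext (gaussTail_succ hq hq1 ha n)]
    exact (hasDerivAt_gaussDeriv hq hq1 ha n y).neg

lemma norm_gaussTail_le (hq : 0 < q) (hq1 : q < 1)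
    (ha : Summable fun k => ‖a k‖ ^ 2 * (q ^ k)⁻¹) (n : ℕ) (y : ℝ) :
    ‖gaussTail a n y‖ ≤ 2 * (weightedNorm q a * derivBound q n) := by
  obtain ⟨h1, h2⟩ := integrable_gaussDeriv hq hq1 ha n
  exact (norm_integral_le_integral_norm _).trans ((setIntegral_le_integral h1.norm
    (Eventually.of_forall fun t => norm_nonneg _)).trans h2)

lemma summable_derivBound (hq1 : q < 1) {R : ℝ} (hR : 0 ≤ R) :
    Summable (fun n => derivBound q n * R ^ n / (n ! : ℝ)) := by
  have hp : 0 < 1 - q := by linarith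
  set S : ℝ := R / √(1 - q) with hS
  have hmaj : Summable fun n : ℕ => (√(1 - q))⁻¹ * ((2 * S ^ 2) ^ n / (n ! : ℝ) + (1 / 2) ^ n) :=
    -- With s = S^n/√n!, the majorant comes from s ≤ 2^n s² + 2^{-n}, which trades √n! for n!.
    ((Real.summable_pow_div_factorial _).add
      (summable_geometric_of_lt_one (by norm_num) (by norm_num))).mul_left _
  refine Summable.of_nonneg_of_le (fun n => by rw [derivBound]; positivity) (fun n => ?_) hmaj
  have hsp : 0 < √(1 - q) := Real.sqrt_pos.mpr hp
  have hf : 0 < √(n ! : ℝ) := by positivity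
  have hf2 : (n ! : ℝ) = √(n ! : ℝ) ^ 2 := (Real.sq_sqrt (by positivity)).symm
  have e0 : √((1 - q) ^ (n + 1)) = √(1 - q) ^ (n + 1) := by
    rw [Real.sqrt_eq_iff_mul_self_eq_of_pos (by positivity), ← mul_pow, Real.mul_self_sqrt hp.le]
  have e1 : derivBound q n * R ^ n / (n ! : ℝ) = (√(1 - q))⁻¹ * (S ^ n / √(n ! : ℝ)) := by
    rw [derivBound, Real.sqrt_div (by positivity), e0, hS, div_pow]
    nth_rewrite 2 [hf2]
    field_simp
    ring
  rw [e1]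
  refine mul_le_mul_of_nonneg_left ?_ (by positivity)
  have h2 : (0 : ℝ) < 2 ^ n := by positivity
  have e2 : (2 * S ^ 2) ^ n / (n ! : ℝ) + (1 / 2) ^ n - S ^ n / √(n ! : ℝ) =
      ((2 ^ n * (S ^ n / √(n ! : ℝ)) - 1) ^ 2 + 2 ^ n * (S ^ n / √(n ! : ℝ))) / 2 ^ n := by
    nth_rewrite 1 [hf2]
    rw [mul_pow, ← pow_mul, mul_comm 2 n, pow_mul, one_div, inv_pow]
    field_simp
    ring
  rw [← sub_nonneg, e2]
  positivity

lemma summable_gaussTail_bound (hq1 : q < 1) (C : ℝ) {R : ℝ} (hR : 0 ≤ R) :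
    Summable fun n => 2 * (C * derivBound q n) * R ^ n / (n ! : ℝ) :=
  ((summable_derivBound hq1 hR).mul_left (2 * C)).congr fun n => by ring

lemma hasSum_gaussTail (hq : 0 < q) (hq1 : q < 1)
    (ha : Summable fun k => ‖a k‖ ^ 2 * (q ^ k)⁻¹) (z : ℝ) :
    HasSum (fun n => (z ^ n / (n ! : ℝ)) • gaussTail a n 0) (gaussTail a 0 z) := by
  simpa using hasSum_taylor (hasDerivAt_gaussTail hq hq1 ha) (norm_gaussTail_le hq hq1 ha)
    (fun R hR => summable_gaussTail_bound hq1 _ hR) 0 z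

/-- Obtained as minus the derivative of the tail, so that the L¹ bounds suffice. -/
lemma analyticAt_gaussDeriv_zero (hq : 0 < q) (hq1 : q < 1)
    (ha : Summable fun k => ‖a k‖ ^ 2 * (q ^ k)⁻¹) (y : ℝ) :
    AnalyticAt ℝ (gaussDeriv a 0) y := by
  have h := analyticAt_of_hasDerivAt_bound (hasDerivAt_gaussTail hq hq1 ha)
    (norm_gaussTail_le hq hq1 ha) (fun R hR => summable_gaussTail_bound hq1 _ hR) y
  have e : gaussDeriv a 0 = -deriv (gaussTail a 0) := by
    funext t
    rw [Pi.neg_apply, (hasDerivAt_gaussTail hq hq1 ha 0 t).deriv, gaussTail_succ hq hq1 ha, neg_neg]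
  rw [e]
  exact h.deriv.neg

end Series

lemma IsHermiteCoeff.mulGauss_eq {q : ℝ} {a : ℕ → ℂ} {f : ℝ → ℂ} (h : IsHermiteCoeff q a f) :
    mulGauss f = gaussDeriv a 0 := by
  funext y
  rw [mulGauss, gaussDeriv, ← (h.2 y).tsum_eq, ← tsum_mul_right]
  refine tsum_congr fun k => ?_
  rw [derivFactor_zero, one_mul, add_zero, hermiteFun]
  push_cast
  ring

/-! ### Hermite expansion of monomials -/

/-- The moments of the standard normal distribution. -/
def gaussMoment : ℕ → ℕ
  | 0 => 1
  | 1 => 0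
  | n + 2 => (n + 1) * gaussMoment n

/-- The recursion multiplies the square by (n+1)² ≤ (n+2)(n+1). -/
lemma gaussMoment_sq_le : ∀ n, gaussMoment n ^ 2 ≤ n !
  | 0 => by simp [gaussMoment]
  | 1 => by simp [gaussMoment]
  | n + 2 => by
    rw [gaussMoment, mul_pow, Nat.factorial_succ, Nat.factorial_succ, ← mul_assoc]
    exact Nat.mul_le_mul (by nlinarith) (gaussMoment_sq_le n)

open Finset in
-- Both sides reindex to the same sum, since the moment recursion mirrors h_{k+1}' = (k+1) h_k. The
-- boundary terms vanish because the first moment and h_0' are zero.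
lemma sum_gaussMoment_succ_mul_hermite (n : ℕ) :
    ∑ p ∈ antidiagonal n, (n.choose p.1 : Polynomial ℤ) *
        ((gaussMoment (p.2 + 1) : Polynomial ℤ) * Polynomial.hermite p.1) =
      ∑ p ∈ antidiagonal n, (n.choose p.1 : Polynomial ℤ) *
        ((gaussMoment p.2 : Polynomial ℤ) * Polynomial.derivative (Polynomial.hermite p.1)) := by
  cases n with
  | zero => simp [gaussMoment, Polynomial.hermite_zero]
  | succ m =>
    rw [Nat.sum_antidiagonal_succ', Nat.sum_antidiagonal_succ]
    simp only [gaussMoment, Polynomial.hermite_zero, derivative_hermite_succ,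
      Polynomial.derivative_one, Nat.cast_zero, zero_mul, mul_zero, zero_add, Polynomial.C_1]
    refine sum_congr rfl fun p hp => ?_
    have hp' : p.1 + p.2 = m := by simpa using hp
    have h : ((m + 1).choose (p.1 + 1) : Polynomial ℤ) * ((p.1 + 1 : ℕ) : Polynomial ℤ) =
        ((m + 1).choose p.1 : Polynomial ℤ) * ((p.2 + 1 : ℕ) : Polynomial ℤ) := by
      rw [← Nat.cast_mul, ← Nat.cast_mul, Nat.choose_succ_right_eq]
      congr 3
      omega
    push_cast at h ⊢
    linear_combination
      (-(gaussMoment p.2 : Polynomial ℤ) * Polynomial.hermite p.1) * h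

open Finset in
-- In generating functions this is e^{tx} = e^{t²/2} · e^{tx - t²/2}. In the induction, Pascal's
-- rule yields one sum with h_{k+1} = X h_k - h_k' and one with shifted moments; the latter cancels
-- the h_k' terms.
lemma X_pow_eq_sum_hermite (n : ℕ) :
    (Polynomial.X ^ n : Polynomial ℤ) = ∑ p ∈ antidiagonal n, (n.choose p.1 : Polynomial ℤ) *
      ((gaussMoment p.2 : Polynomial ℤ) * Polynomial.hermite p.1) := by
  induction n with
  | zero => simp [gaussMoment, Polynomial.hermite_zero]
  | succ n ih =>
    rw [sum_antidiagonal_choose_succ_mul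
      (fun i j => (gaussMoment j : Polynomial ℤ) * Polynomial.hermite i),
      sum_gaussMoment_succ_mul_hermite, ← sum_add_distrib, pow_succ', ih, mul_sum]
    refine sum_congr rfl fun p hp => ?_
    have hp' : p.1 + p.2 = n := by simpa using hp
    have h : n.choose p.2 = n.choose p.1 := (Nat.choose_symm_of_eq_add hp'.symm).symm
    rw [h, Polynomial.hermite_succ]
    ring

/-- The coefficient of `ĥ_k` in `x^n`. -/
def monomialCoeff (n k : ℕ) : ℝ := n.choose k * gaussMoment (n - k) * √(k ! : ℝ)

lemma monomialCoeff_eq_zero {n k : ℕ} (h : k ∉ Finset.range (n + 1)) : monomialCoeff n k = 0 := by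
  rw [monomialCoeff, Nat.choose_eq_zero_of_lt (by simpa using h)]
  simp

lemma sum_monomialCoeff_mul (n : ℕ) (x : ℝ) :
    ∑ k ∈ Finset.range (n + 1), monomialCoeff n k * hermiteHat k x = x ^ n := by
  have h := congrArg (Polynomial.aeval x) (X_pow_eq_sum_hermite n)
  rw [Finset.Nat.sum_antidiagonal_eq_sum_range_succ
    (fun i j => (n.choose i : Polynomial ℤ) *
      ((gaussMoment j : Polynomial ℤ) * Polynomial.hermite i))] at h
  simp only [map_pow, Polynomial.aeval_X, map_sum, map_mul, map_natCast] at h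
  rw [h]
  refine Finset.sum_congr rfl fun k _ => ?_
  have : √(k ! : ℝ) ≠ 0 := by positivity
  rw [monomialCoeff, hermiteHat]
  field_simp

/-- Bounding the squared moment by (n-k)! turns one of the two binomial coefficients into n!. -/
lemma monomialCoeff_sq_le (n k : ℕ) : monomialCoeff n k ^ 2 ≤ n ! * n.choose k := by
  by_cases hk : k ≤ n
  · have h1 : (gaussMoment (n - k) : ℝ) ^ 2 ≤ ((n - k)! : ℝ) := by
      exact_mod_cast gaussMoment_sq_le (n - k)
    have h2 : (n.choose k : ℝ) * k ! * (n - k)! = n ! := by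
      exact_mod_cast Nat.choose_mul_factorial_mul_factorial hk
    rw [monomialCoeff, mul_pow, mul_pow, Real.sq_sqrt (by positivity), ← h2]
    calc (n.choose k : ℝ) ^ 2 * (gaussMoment (n - k) : ℝ) ^ 2 * k !
        ≤ (n.choose k : ℝ) ^ 2 * ((n - k)! : ℝ) * k ! := by gcongr
      _ = _ := by ring
  · rw [monomialCoeff_eq_zero (by simpa using hk), zero_pow two_ne_zero]
    positivity

/-- The remaining sum of C(n,k) q^{-k} is the binomial theorem. -/
lemma sum_monomialCoeff_sq_le {q : ℝ} (hq : 0 < q) (n : ℕ) :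
    ∑ k ∈ Finset.range (n + 1), monomialCoeff n k ^ 2 * (q ^ k)⁻¹ ≤ n ! * (1 + q⁻¹) ^ n := by
  rw [add_comm 1, add_pow, Finset.mul_sum]
  refine Finset.sum_le_sum fun k _ => ?_
  rw [one_pow, mul_one, inv_pow, mul_comm (q ^ k)⁻¹, ← mul_assoc]
  exact mul_le_mul_of_nonneg_right (monomialCoeff_sq_le n k) (by positivity)

lemma weighted_monomialCoeff_eq_zero (q : ℝ) {n k : ℕ} (h : k ∉ Finset.range (n + 1)) :
    ‖(monomialCoeff n k : ℂ)‖ ^ 2 * (q ^ k)⁻¹ = 0 := by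
  simp [monomialCoeff_eq_zero h]

lemma isHermiteCoeff_monomial (q : ℝ) (n : ℕ) :
    IsHermiteCoeff q (fun k => (monomialCoeff n k : ℂ)) (fun x => (x : ℂ) ^ n) := by
  refine ⟨summable_of_ne_finset_zero fun k hk => weighted_monomialCoeff_eq_zero q hk, fun x => ?_⟩
  simp only [← Complex.ofReal_pow]
  rw [← sum_monomialCoeff_mul n x, Complex.ofReal_sum]
  simp_rw [Complex.ofReal_mul]
  exact hasSum_sum_of_ne_finset_zero fun k hk => by simp [monomialCoeff_eq_zero hk]

lemma isHermiteCoeff_hermiteHat (q : ℝ) (k : ℕ) :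
    IsHermiteCoeff q (Pi.single k 1) (fun x => (hermiteHat k x : ℂ)) := by
  refine ⟨summable_of_ne_finset_zero (s := {k}) fun j hj => ?_, fun x => ?_⟩
  · simp [Pi.single_eq_of_ne (Finset.notMem_singleton.mp hj)]
  · have h := hasSum_single (f := fun j => (Pi.single k 1 : ℕ → ℂ) j * (hermiteHat j x : ℂ)) k
      (fun j hj => by simp [Pi.single_eq_of_ne hj])
    simpa using h

/-- At 0 the three-term recursion reads h_{n+2}(0) = -(n+1) h_n(0), so non-vanishing propagates in
steps of two. Needed for T^{(n)} ≠ 0. -/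
lemma aeval_zero_hermite_ne_zero (n : ℕ) :
    (Polynomial.aeval (0 : ℝ) (Polynomial.hermite n) : ℝ) ≠ 0 ∨
      (Polynomial.aeval (0 : ℝ) (Polynomial.hermite (n + 1)) : ℝ) ≠ 0 := by
  induction n with
  | zero => simp [Polynomial.hermite_zero]
  | succ n ih =>
    rcases ih with h | h
    · right
      rw [aeval_hermite_add_two, zero_mul, zero_sub]
      exact neg_ne_zero.mpr (mul_ne_zero (by positivity) h)
    · exact Or.inl h

lemma hermiteFun_zero_ne_zero {n : ℕ}
    (h : (Polynomial.aeval (0 : ℝ) (Polynomial.hermite n) : ℝ) ≠ 0) : hermiteFun n 0 ≠ 0 :=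
  mul_ne_zero (div_ne_zero h (by positivity)) (stdGaussianPDF_pos 0).ne'

/-- Taking k = 1 or 2 makes the tail integral a nonzero multiple of ĥ_n φ or ĥ_{n+1} φ at 0, and one
of these is nonzero. -/
lemma exists_integral_Ioi_hermiteFun_ne_zero (n : ℕ) :
    ∃ k, ∫ t in Set.Ioi (0 : ℝ), hermiteFun (k + n) t ≠ 0 := by
  have key : ∀ m, hermiteFun m 0 ≠ 0 → ∫ t in Set.Ioi (0 : ℝ), hermiteFun (m + 1) t ≠ 0 :=
    fun m hm h => hm (by rw [← integral_Ioi_hermiteFun_succ, h, mul_zero])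
  rcases aeval_zero_hermite_ne_zero n with h | h
  · exact ⟨1, by simpa only [add_comm 1 n] using key n (hermiteFun_zero_ne_zero h)⟩
  · exact ⟨2, by simpa only [add_comm 2 n] using key (n + 1) (hermiteFun_zero_ne_zero h)⟩

/-! ### Linearity of the tail integrals in the coefficients -/

lemma gaussTail_single (n k : ℕ) (y : ℝ) : gaussTail (Pi.single k 1) n y =
    ((derivFactor n k * ∫ t in Set.Ioi y, hermiteFun (k + n) t : ℝ) : ℂ) := by
  have e : gaussDeriv (Pi.single k 1) n =
      fun t => ((derivFactor n k * hermiteFun (k + n) t : ℝ) : ℂ) := by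
    funext t
    rw [gaussDeriv, tsum_eq_single k fun j hj => by simp [Pi.single_eq_of_ne hj]]
    simp
  rw [gaussTail, e, integral_complex_ofReal, integral_const_mul]

lemma gaussTail_add {q : ℝ} (hq : 0 < q) (hq1 : q < 1) {a b : ℕ → ℂ}
    (ha : Summable fun k => ‖a k‖ ^ 2 * (q ^ k)⁻¹)
    (hb : Summable fun k => ‖b k‖ ^ 2 * (q ^ k)⁻¹) (n : ℕ) (y : ℝ) :
    gaussTail (a + b) n y = gaussTail a n y + gaussTail b n y := by
  have hs : ∀ {c : ℕ → ℂ}, (Summable fun k => ‖c k‖ ^ 2 * (q ^ k)⁻¹) → ∀ t, Summable fun k =>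
      c k * ((derivFactor n k * hermiteFun (k + n) t : ℝ) : ℂ) := fun {c} hc t =>
    Summable.of_norm_bounded ((summable_norm_mul_derivFactor hq hq1 hc (n + 1)).1.mul_left 2)
      fun k => norm_gaussDeriv_term_le c n k t
  have e : ∀ t, gaussDeriv (a + b) n t = gaussDeriv a n t + gaussDeriv b n t := fun t => by
    rw [gaussDeriv, gaussDeriv, gaussDeriv, ← (hs ha t).tsum_add (hs hb t)]
    exact tsum_congr fun k => by rw [Pi.add_apply, add_mul]
  simp_rw [gaussTail, e]
  exact integral_add (integrable_gaussDeriv hq hq1 ha n).1.integrableOn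
    (integrable_gaussDeriv hq hq1 hb n).1.integrableOn

lemma gaussTail_smul (c : ℂ) (a : ℕ → ℂ) (n : ℕ) (y : ℝ) :
    gaussTail (c • a) n y = c * gaussTail a n y := by
  have e : ∀ t, gaussDeriv (c • a) n t = c * gaussDeriv a n t := fun t => by
    rw [gaussDeriv, gaussDeriv, ← tsum_mul_left]
    exact tsum_congr fun k => by rw [Pi.smul_apply, smul_eq_mul, mul_assoc]
  simp_rw [gaussTail, e]
  exact integral_const_mul _ _

/-! ### The functionals and operators on H_q -/

namespace HermiteSpace

variable {q : Set.Ioo (0 : ℝ) 1}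

lemma norm_eq_weightedNorm (f : HermiteSpace q) : ‖f‖ = weightedNorm q f.coeff := by
  rw [← norm_toLp, lp.norm_eq_tsum_rpow (by norm_num), weightedNorm, Real.sqrt_eq_rpow]
  simp only [ENNReal.toReal_ofNat, Real.rpow_ofNat]
  congr 1
  refine tsum_congr fun n => ?_
  have h : 0 < (q : ℝ) ^ n := pow_pos q.2.1 n
  simp only [toLp_apply, norm_mul, Complex.norm_real, mul_pow, Real.norm_eq_abs, sq_abs, inv_pow,
    Real.sq_sqrt h.le]

lemma summable_coeff (f : HermiteSpace q) : Summable fun n => ‖f.coeff n‖ ^ 2 * ((q : ℝ) ^ n)⁻¹ :=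
  f.isHermiteCoeff_coeff.1

lemma add_apply (f g : HermiteSpace q) (x : ℝ) : (f + g) x = f x + g x := rfl

lemma smul_apply (c : ℂ) (f : HermiteSpace q) (x : ℝ) : (c • f) x = c * f x := rfl

/-- The monomial `x^n` as an element of `H_q`. -/
def monomial (q : Set.Ioo (0 : ℝ) 1) (n : ℕ) : HermiteSpace q :=
  ⟨fun x => (x : ℂ) ^ n, _, isHermiteCoeff_monomial q n⟩

lemma monomial_apply (n : ℕ) (x : ℝ) : monomial q n x = (x : ℂ) ^ n := rfl

lemma monomial_ne_zero (n : ℕ) : monomial q n ≠ 0 := fun h => by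
  have h1 : monomial q n 1 = (0 : HermiteSpace q) 1 := by rw [h]
  rw [monomial_apply, Complex.ofReal_one, one_pow] at h1
  exact one_ne_zero h1

lemma norm_monomial_le (n : ℕ) : ‖monomial q n‖ ≤ √((n ! : ℝ) * (1 + (q : ℝ)⁻¹) ^ n) := by
  rw [norm_eq_weightedNorm, coeff_eq (f := monomial q n) (isHermiteCoeff_monomial q n),
    weightedNorm, tsum_eq_sum fun k hk => weighted_monomialCoeff_eq_zero q hk]
  refine Real.sqrt_le_sqrt ((le_of_eq ?_).trans (sum_monomialCoeff_sq_le q.2.1 n))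
  refine Finset.sum_congr rfl fun k _ => ?_
  rw [Complex.norm_real, Real.norm_eq_abs, sq_abs]

/-- Evaluation at a point is a bounded functional on `H_q`. -/
def evalCLM (q : Set.Ioo (0 : ℝ) 1) (x : ℝ) : HermiteSpace q →L[ℂ] ℂ :=
  LinearMap.mkContinuous
    { toFun := fun f => f x
      map_add' := fun f g => add_apply f g x
      map_smul' := fun c f => smul_apply c f x }
    √(∑' k, |hermiteHat k x| ^ 2 * (q : ℝ) ^ k) fun f => by
      have hs := summable_hermiteHat_sq q.2.1 q.2.2 x
      simp_rw [← sq_abs (hermiteHat _ x)] at hs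
      obtain ⟨h1, h2⟩ := summable_and_tsum_mul_le (fun k => norm_nonneg (f.coeff k))
        (fun k => abs_nonneg (hermiteHat k x)) (fun k => pow_pos q.2.1 k) f.summable_coeff hs
      rw [norm_eq_weightedNorm, mul_comm]
      change ‖f x‖ ≤ _
      rw [← (f.isHermiteCoeff_coeff.2 x).tsum_eq]
      refine (norm_tsum_le_tsum_norm (h1.congr fun k => ?_)).trans ((le_of_eq ?_).trans h2)
      · rw [norm_mul, Complex.norm_real, Real.norm_eq_abs]
      · exact tsum_congr fun k => by rw [norm_mul, Complex.norm_real, Real.norm_eq_abs]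

/-- The functional `f ↦ ∫_0^∞ (f φ)^{(n)}`. -/
def tailFunctional (q : Set.Ioo (0 : ℝ) 1) (n : ℕ) : HermiteSpace q →L[ℂ] ℂ :=
  LinearMap.mkContinuous
    { toFun := fun f => gaussTail f.coeff n 0
      map_add' := fun f g => by
        rw [coeff_add, gaussTail_add q.2.1 q.2.2 f.summable_coeff g.summable_coeff]
      map_smul' := fun c f => by
        rw [coeff_smul, gaussTail_smul, RingHom.id_apply, smul_eq_mul] }
    (2 * derivBound q n) fun f => by
      rw [norm_eq_weightedNorm]
      exact (norm_gaussTail_le q.2.1 q.2.2 f.summable_coeff n 0).trans (le_of_eq (by ring))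

lemma tailFunctional_apply (n : ℕ) (f : HermiteSpace q) :
    tailFunctional q n f = gaussTail f.coeff n 0 := rfl

lemma norm_tailFunctional_le (n : ℕ) : ‖tailFunctional q n‖ ≤ 2 * derivBound q n :=
  LinearMap.mkContinuous_norm_le _ (by rw [derivBound]; positivity) _

lemma exists_tailFunctional_ne_zero (n : ℕ) : ∃ f : HermiteSpace q, tailFunctional q n f ≠ 0 := by
  obtain ⟨k, hk⟩ := exists_integral_Ioi_hermiteFun_ne_zero n
  let F : HermiteSpace q := ⟨_, _, isHermiteCoeff_hermiteHat q k⟩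
  refine ⟨F, ?_⟩
  rw [tailFunctional_apply, coeff_eq (f := F) (isHermiteCoeff_hermiteHat q k), gaussTail_single]
  have h : derivFactor n k ≠ 0 := by
    rw [← abs_pos, abs_derivFactor]
    positivity
  exact_mod_cast mul_ne_zero h hk

/-- The operator `T^{(n)}`. -/
def termCLM (q : Set.Ioo (0 : ℝ) 1) (n : ℕ) : HermiteSpace q →L[ℂ] HermiteSpace q :=
  (tailFunctional q n).smulRight (((-1) ^ n * (1 / (n ! : ℂ))) • monomial q n)

lemma termCLM_apply (n : ℕ) (f : HermiteSpace q) (x : ℝ) :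
    termCLM q n f x = (-1) ^ n * (x : ℂ) ^ n * (1 / (n ! : ℂ)) * gaussTail f.coeff n 0 := by
  change gaussTail f.coeff n 0 * (((-1) ^ n * (1 / (n ! : ℂ))) * (x : ℂ) ^ n) = _
  ring

lemma finrank_range_termCLM (n : ℕ) :
    Module.finrank ℂ (LinearMap.range (termCLM q n).toLinearMap) = 1 := by
  have hv : ((-1) ^ n * (1 / (n ! : ℂ))) • monomial q n ≠ 0 :=
    smul_ne_zero (mul_ne_zero (by simp) (one_div_ne_zero
      (Nat.cast_ne_zero.mpr n.factorial_ne_zero))) (monomial_ne_zero n)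
  have h : LinearMap.range (termCLM q n).toLinearMap =
      Submodule.span ℂ {((-1) ^ n * (1 / (n ! : ℂ))) • monomial q n} := by
    refine le_antisymm ?_ ?_
    · rintro _ ⟨f, rfl⟩
      exact Submodule.smul_mem _ _ (Submodule.mem_span_singleton_self _)
    · obtain ⟨f, hf⟩ := exists_tailFunctional_ne_zero (q := q) n
      rw [Submodule.span_singleton_le_iff_mem]
      refine ⟨(tailFunctional q n f)⁻¹ • f, ?_⟩
      rw [map_smul]
      exact inv_smul_smul₀ hf _
  rw [h, finrank_span_singleton hv]

/-- The operator factors through ℂ, which is locally compact. -/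
lemma isCompactOperator_termCLM (n : ℕ) : IsCompactOperator (termCLM q n) := by
  have h : IsCompactOperator (tailFunctional q n) :=
    isCompactOperator_of_locallyCompactSpace_dom (tailFunctional q n)
  exact h.clm_comp (ContinuousLinearMap.toSpanSingleton ℂ
    (((-1) ^ n * (1 / (n ! : ℂ))) • monomial q n))

/-- The bounds √(n!/(1-q)^{n+1}) and √(n!(1+q⁻¹)^n) together produce n!, cancelled by 1/n!; what
remains grows like r(q)^{-n}. -/
lemma norm_termCLM_le (n : ℕ) :
    ‖termCLM q n‖ ≤ 2 * (√(1 - (q : ℝ)))⁻¹ * ((radius q)⁻¹) ^ n := by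
  have hp : 0 < 1 - (q : ℝ) := sub_pos.mpr q.2.2
  have hq : 0 < 1 + (q : ℝ)⁻¹ := by
    have := inv_pos.mpr q.2.1
    linarith
  have hf : (0 : ℝ) < n ! := by positivity
  have e : derivBound q n * √((n ! : ℝ) * (1 + (q : ℝ)⁻¹) ^ n) =
      n ! * ((√(1 - (q : ℝ)))⁻¹ * ((radius q)⁻¹) ^ n) := by
    have hpow : ∀ x : ℝ, 0 ≤ x → √(x ^ n) = √x ^ n := fun x hx => by
      rw [Real.sqrt_eq_iff_mul_self_eq (by positivity) (by positivity), ← mul_pow,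
        Real.mul_self_sqrt hx]
    have h : (n ! : ℝ) / (1 - q) ^ (n + 1) * (n ! * (1 + (q : ℝ)⁻¹) ^ n) =
        (n ! : ℝ) ^ 2 * ((1 - q : ℝ)⁻¹ * (((1 - q) / (1 + (q : ℝ)⁻¹))⁻¹) ^ n) := by
      rw [inv_div, div_pow]
      field_simp
      ring
    rw [derivBound, radius, ← Real.sqrt_mul (by positivity), h, Real.sqrt_mul (by positivity),
      Real.sqrt_sq hf.le, Real.sqrt_mul (by positivity), hpow _ (by positivity), Real.sqrt_inv,
      Real.sqrt_inv]
  have hD : 0 ≤ derivBound q n := Real.sqrt_nonneg _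
  rw [termCLM, ContinuousLinearMap.norm_smulRight_apply, norm_smul, norm_mul, norm_pow, norm_neg,
    norm_one, one_pow, one_mul, norm_div, norm_one, RCLike.norm_natCast]
  calc ‖tailFunctional q n‖ * (1 / (n ! : ℝ) * ‖monomial q n‖)
      ≤ 2 * derivBound q n * (1 / (n ! : ℝ) * √((n ! : ℝ) * (1 + (q : ℝ)⁻¹) ^ n)) := by
        have h1 := norm_tailFunctional_le (q := q) n
        have h2 := norm_monomial_le (q := q) n
        gcongr
    _ = 2 * (1 / (n ! : ℝ)) * (derivBound q n * √((n ! : ℝ) * (1 + (q : ℝ)⁻¹) ^ n)) := by ring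
    _ = _ := by
        rw [e]
        field_simp

lemma summable_norm_smul_termCLM {ρ : ℝ} (hρ : |ρ| < radius q) :
    Summable fun n => ‖(ρ : ℂ) ^ n • termCLM q n‖ := by
  have hr : 0 < radius q := (abs_nonneg ρ).trans_lt hρ
  refine Summable.of_nonneg_of_le (fun n => norm_nonneg _) (fun n => ?_)
    ((summable_geometric_of_lt_one (div_nonneg (abs_nonneg ρ) hr.le)
      ((div_lt_one hr).mpr hρ)).mul_left (2 * (√(1 - (q : ℝ)))⁻¹))
  rw [norm_smul, norm_pow, Complex.norm_real, Real.norm_eq_abs, div_eq_mul_inv, mul_pow]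
  have := mul_le_mul_of_nonneg_left (norm_termCLM_le (q := q) n) (pow_nonneg (abs_nonneg ρ) n)
  linarith

lemma analyticAt (f : HermiteSpace q) (x : ℝ) : AnalyticAt ℝ (f : ℝ → ℂ) x := by
  have h1 : AnalyticAt ℝ (mulGauss f) x := by
    rw [f.isHermiteCoeff_coeff.mulGauss_eq]
    exact analyticAt_gaussDeriv_zero q.2.1 q.2.2 f.summable_coeff x
  -- The function 1/φ, by which fφ is multiplied to recover f.
  have h2 : AnalyticAt ℝ (fun y : ℝ => √(2 * Real.pi) * Real.exp (y ^ 2 / 2)) x := by fun_prop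
  have h3 : AnalyticAt ℝ
      (fun y : ℝ => ((√(2 * Real.pi) * Real.exp (y ^ 2 / 2) : ℝ) : ℂ)) x :=
    (Complex.ofRealCLM.analyticAt _).comp h2
  refine (h1.mul h3).congr (Eventually.of_forall fun y => ?_)
  have e : stdGaussianPDF y * (√(2 * Real.pi) * Real.exp (y ^ 2 / 2)) = 1 := by
    have : √(2 * Real.pi) ≠ 0 := by positivity
    rw [stdGaussianPDF_eq, Real.exp_neg]
    field_simp
  rw [Pi.mul_apply, mulGauss, mul_assoc, ← Complex.ofReal_mul, e, Complex.ofReal_one, mul_one]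

lemma iteratedDeriv_mulGauss (f : HermiteSpace q) (n : ℕ) :
    iteratedDeriv n (mulGauss f) = gaussDeriv f.coeff n := by
  rw [f.isHermiteCoeff_coeff.mulGauss_eq]
  exact iteratedDeriv_eq_of_hasDerivAt
    (hasDerivAt_gaussDeriv q.2.1 q.2.2 f.summable_coeff) n

/-- One numerical series is summed twice: by applying the norm-convergent operator series to f and
evaluating at x, and by Taylor's formula for the tail at -ρx. -/
lemma tsum_termCLM_apply {ρ : ℝ} (hρ : |ρ| < radius q) (f : HermiteSpace q) (x : ℝ) :
    (∑' n, (ρ : ℂ) ^ n • termCLM q n) f x = persistenceIntegral ρ f x := by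
  have h := (summable_norm_smul_termCLM hρ).of_norm.hasSum
  have h1 := (((ContinuousLinearMap.apply ℂ (HermiteSpace q) f).hasSum h).mapL (evalCLM q x))
  have h2 := hasSum_gaussTail q.2.1 q.2.2 f.summable_coeff (-(ρ * x))
  rw [persistenceIntegral, f.isHermiteCoeff_coeff.mulGauss_eq]
  refine h1.unique ((funext fun n => ?_ : _ = fun n => _) ▸ h2)
  change _ = (ρ : ℂ) ^ n * termCLM q n f x
  rw [termCLM_apply, Complex.real_smul, neg_pow, mul_pow]
  push_cast
  ring

lemma isCompactOperator_tsum {ρ : ℝ} (hρ : |ρ| < radius q) :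
    IsCompactOperator
      (∑' n, (ρ : ℂ) ^ n • termCLM q n : HermiteSpace q →L[ℂ] HermiteSpace q) := by
  refine isCompactOperator_of_tendsto
    (summable_norm_smul_termCLM hρ).of_norm.hasSum.tendsto_sum_nat (Eventually.of_forall fun N => ?_)
  exact Submodule.sum_mem (compactOperator (RingHom.id ℂ) (HermiteSpace q) (HermiteSpace q))
    fun n _ => (isCompactOperator_termCLM n).smul ((ρ : ℂ) ^ n)

end HermiteSpace

/-! ### The largest radius -/

lemma radius_eq {q : ℝ} (hq : 0 < q) : radius q = √(q * (1 - q) / (1 + q)) := by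
  rw [radius]
  congr 1
  field_simp
  ring

lemma sqrt_two_sub_one_pos : 0 < √2 - 1 := by
  rw [sub_pos, Real.lt_sqrt (by norm_num)]
  norm_num

lemma radius_sqrt_two_sub_one : radius (√2 - 1) = √2 - 1 := by
  have h2 : √2 ^ 2 = 2 := Real.sq_sqrt (by norm_num)
  have h0 := sqrt_two_sub_one_pos
  rw [radius_eq h0, Real.sqrt_eq_iff_mul_self_eq_of_pos h0, eq_div_iff (by linarith)]
  nlinarith

lemma radius_lt {q : ℝ} (hq : 0 < q) (h : q ≠ √2 - 1) : radius q < √2 - 1 := by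
  have h2 : √2 ^ 2 = 2 := Real.sq_sqrt (by norm_num)
  have h0 := sqrt_two_sub_one_pos
  have hs : 0 < (q - (√2 - 1)) ^ 2 := by
    have := sub_ne_zero.mpr h
    positivity
  -- The claim becomes q(1-q) < (√2-1)²(1+q), and the difference of the two sides is exactly (q -
  -- (√2-1))².
  rw [radius_eq hq, Real.sqrt_lt' h0, div_lt_iff₀ (by linarith)]
  nlinarith

end HermiteMA

end

theorem theorem1 :
    (∀ q : Set.Ioo (0 : ℝ) 1,
      (∀ f : HermiteMA.HermiteSpace q, AnalyticOnNhd ℝ (f : ℝ → ℂ) Set.univ) ∧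
      ∃ T : ℕ → (HermiteMA.HermiteSpace q →L[ℂ] HermiteMA.HermiteSpace q),
        (∀ n, ∀ f : HermiteMA.HermiteSpace q,
          IntegrableOn (iteratedDeriv n (HermiteMA.mulGauss f)) (Set.Ioi 0) volume ∧
          ∀ x : ℝ, T n f x = HermiteMA.seriesTerm n f x) ∧
        (∀ n, Module.finrank ℂ (LinearMap.range (T n).toLinearMap) = 1) ∧
        ∀ ρ : ℝ, |ρ| < HermiteMA.radius q →
          (∀ f : HermiteMA.HermiteSpace q, ∀ x : ℝ,
            IntegrableOn (HermiteMA.mulGauss f) (Set.Ioi (-(ρ * x))) volume) ∧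
          ∃ Tρ : HermiteMA.HermiteSpace q →L[ℂ] HermiteMA.HermiteSpace q,
            (∀ f : HermiteMA.HermiteSpace q, ∀ x : ℝ,
              Tρ f x = HermiteMA.persistenceIntegral ρ f x) ∧
            IsCompactOperator Tρ ∧
            Summable (fun n => ‖(ρ : ℂ) ^ n • T n‖) ∧
            HasSum (fun n => (ρ : ℂ) ^ n • T n) Tρ) ∧
    √2 - 1 ∈ Set.Ioo (0 : ℝ) 1 ∧
    HermiteMA.radius (√2 - 1) = √2 - 1 ∧
    (∀ q ∈ Set.Ioo (0 : ℝ) 1, q ≠ √2 - 1 → HermiteMA.radius q < √2 - 1) := by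
  refine ⟨fun q => ⟨fun f x _ => f.analyticAt x, HermiteMA.HermiteSpace.termCLM q,
      fun n f => ?_, HermiteMA.HermiteSpace.finrank_range_termCLM, fun ρ hρ => ⟨fun f x => ?_,
        ∑' n, (ρ : ℂ) ^ n • HermiteMA.HermiteSpace.termCLM q n,
        HermiteMA.HermiteSpace.tsum_termCLM_apply hρ,
        HermiteMA.HermiteSpace.isCompactOperator_tsum hρ,
        HermiteMA.HermiteSpace.summable_norm_smul_termCLM hρ,
        (HermiteMA.HermiteSpace.summable_norm_smul_termCLM hρ).of_norm.hasSum⟩⟩,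
    ⟨HermiteMA.sqrt_two_sub_one_pos, ?_⟩, HermiteMA.radius_sqrt_two_sub_one,
    fun q hq h => HermiteMA.radius_lt hq.1 h⟩
  · rw [f.iteratedDeriv_mulGauss]
    refine ⟨(HermiteMA.integrable_gaussDeriv q.2.1 q.2.2 f.summable_coeff n).1.integrableOn,
      fun x => ?_⟩
    rw [HermiteMA.seriesTerm, f.iteratedDeriv_mulGauss]
    exact HermiteMA.HermiteSpace.termCLM_apply n f x
  · rw [f.isHermiteCoeff_coeff.mulGauss_eq]
    exact (HermiteMA.integrable_gaussDeriv q.2.1 q.2.2 f.summable_coeff 0).1.integrableOn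
  · rw [sub_lt_iff_lt_add, Real.sqrt_lt' (by norm_num)]
    norm_num
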